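/- \textbf{Setting.} Graphs are multigraphs: each edge \(e\) has an unordered pair \(\xi(e)=\{e^-,e^+\}\) of distinct endpoints; \(e\cap f\) denotes the set of common endpoints of \(e\) and \(f\), and \(\deg(v)\) the number of edges with endpoint \(v\). A \emph{simple iterated graph system} consists of a finite connected graph \(G_1=(V_1,E_1,\xi_1)\) whose edges have labelled endpoints \(e^-\neq e^+\), a finite non-empty set \(I\), and two injective maps \(\phi_-,\phi_+\colon I\to V_1\) with images \(I_\pm=\phi_\pm(I)\), such that \(I_-\cap I_+=\varnothing\) and no edge of \(G_1\) has both endpoints in \(I_-\) or both endpoints in \(I_+\). Replacement graphs are defined recursively: given \(G_n=(V_n,E_n,\xi_n)\), put \(V_{n+1}=(V_1\times E_n)/\!\sim\), where \((\phi_s(i),e)\sim(\phi_t(i),f)\) for all \(i\in I\), \(e,f\in E_n\) and signs \(s,t\in\{-,+\}\) with \(e^s=f^t\); put \(E_{n+1}=E_1\times E_n\) and \((e,f)^\pm=[(e^\pm,f)]\); and let \(\pi(e,f)=f\). The system is \emph{doubling} if \(\deg(v)=1\) in \(G_1\) for all \(v\in I_-\cup I_+\); \emph{non-degenerate} if no edge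 of \(G_1\) has one endpoint in \(I_-\) and the other in \(I_+\); \emph{symmetric} if there is an isomorphism \(\eta\) of the (undirected) graph \(G_1\) with \(\eta\circ\phi_\pm=\phi_\mp\). Let \(\Sigma\) be the set of sequences \((e_n)_{n\ge1}\) with \(e_n\in E_n\) and \(\pi(e_{n+1})=e_n\) for all \(n\), and write \((e_n)\sim(f_n)\) if \(e_n\cap f_n\neq\varnothing\) for all \(n\). The limit space is \(X=\Sigma/\!\sim\). Let \(L_*\) be the path distance from \(I_-\) to \(I_+\) in \(G_1\). For distinct \(v,w\in V_n\) let \[ d_n(v,w)=\inf_{\Omega}\sum_{e\in\Omega}L_*^{-|e|}, \] where \(|e|=k\) for \(e\in E_k\) and the infimum is over all \(\Omega\subset\bigcup_{k=1}^nE_k\) such that \(v\) and \(w\) are joined by a path in \(G_n\) each of whose edges \(g\) satisfies \(\pi^{\,j}(g)\in\Omega\) for some \(0\le j<n\); let \(d_n(v,v)=0\). For \(e,f\in E_n\) let \(d_n(e,f)=\min\{d_n(v,w): v\in\xi_n(e),\,w\in\xi_n(f)\}\). The intrinsic metric on \(X\) is \[ d_{L_*}([(e_n)],[(f_n)])=\lim_{n\to\infty}d_n(e_n,f_n).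 \] \textbf{Proposition.} Let \(X\) be a symmetric Laakso-type fractal space, i.e.\ the limit space of a simple iterated graph system that is doubling, non-degenerate and symmetric. Then \(\sim\) is an equivalence relation on \(\Sigma\), the limit above exists and gives a well-defined metric \(d_{L_*}\) on \(X\), and \((X,d_{L_*})\) is approximately self-similar: there is a constant \(L>1\) such that for every \(x\in X\) and every \(r\in(0,\operatorname{diam}(X,d_{L_*})]\) there are an open set \(U\subset X\) and a surjective map \(f\colon B(x,r)\to U\), where \(B(x,r)\) is the open ball, with \[ L^{-1}\,\frac{d_{L_*}(y,z)}{r}\le d_{L_*}(f(y),f(z))\le L\,\frac{d_{L_*}(y,z)}{r}\qquad\text{for all }y,z\in B(x,r). \] -/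

import Mathlib

open Filter Topology

universe u w

/-- A multigraph whose edges `e` carry labelled endpoints: `G.endpt false e` is `e⁻` and
`G.endpt true e` is `e⁺`.  The underlying graph is undirected: its endpoint map is `G.ends`. -/
structure LabelledGraph where
  V : Type u
  E : Type u
  endpt : Bool → E → V

namespace LabelledGraph

variable (G : LabelledGraph.{u})

/-- The endpoint map `ξ(e) = {e⁻, e⁺}`. -/
def ends (e : G.E) : Sym2 G.V := s(G.endpt false e, G.endpt true e)

/-- `G.IsPath v [e₁, …, e_k] w`: the edges `e₁, …, e_k` form a path from `v` to `w`, that is, there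
are vertices `v = v₀, v₁, …, v_k = w` with `ξ(e_i) = {v_{i-1}, v_i}` for all `i`. -/
def IsPath : G.V → List G.E → G.V → Prop
  | v, [], w => v = w
  | v, e :: l, w => ∃ v' : G.V, G.ends e = s(v, v') ∧ IsPath v' l w

/-- Any two vertices are joined by a path. -/
def IsConnected : Prop := ∀ v w : G.V, ∃ l : List G.E, G.IsPath v l w

/-- The number of edges having `v` as an endpoint. -/
noncomputable def degree (v : G.V) : ℕ := Set.ncard {e : G.E | v ∈ G.ends e}

/-- The edges `e` and `f` share an endpoint: `e ∩ f ≠ ∅`. -/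
def Meets (e f : G.E) : Prop := ∃ v : G.V, v ∈ G.ends e ∧ v ∈ G.ends f

end LabelledGraph

/-- A simple iterated graph system.  The two gluing maps are `φ false = φ₋` and `φ true = φ₊`, and
the endpoint labels of the generator are the canonical ones, so that the gluing map attached to
the endpoint `e⁻` (resp. `e⁺`) of an edge `e` is `φ₋` (resp. `φ₊`). -/
structure SimpleIGS where
  /-- the generator `G₁` -/
  gen : LabelledGraph.{u}
  /-- the gluing set -/
  I : Type w
  /-- the gluing maps `φ₋`, `φ₊` -/
  φ : Bool → I → gen.V
  finite_V : Finite gen.V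
  finite_E : Finite gen.E
  finite_I : Finite I
  nonempty_I : Nonempty I
  /-- the two endpoints of an edge are distinct -/
  no_loops : ∀ e : gen.E, gen.endpt false e ≠ gen.endpt true e
  connected : gen.IsConnected
  φ_injective : ∀ s : Bool, Function.Injective (φ s)
  /-- `I₋ ∩ I₊ = ∅` -/
  disjoint_ranges : Disjoint (Set.range (φ false)) (Set.range (φ true))
  /-- no edge has both endpoints in `I₋`, or both endpoints in `I₊` -/
  no_edge_in_range : ∀ (s : Bool) (f : gen.E),
    ¬ (gen.endpt false f ∈ Set.range (φ s) ∧ gen.endpt true f ∈ Set.range (φ s))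

namespace SimpleIGS

variable (S : SimpleIGS.{u, w})

/-- Every vertex of `I₋ ∪ I₊` has degree one. -/
def IsDoubling : Prop := ∀ (s : Bool) (i : S.I), S.gen.degree (S.φ s i) = 1

/-- No edge has one endpoint in `I₋` and the other one in `I₊`. -/
def IsNonDegenerate : Prop := ∀ (s : Bool) (e : S.gen.E),
  ¬ (S.gen.endpt false e ∈ Set.range (S.φ s) ∧ S.gen.endpt true e ∈ Set.range (S.φ !s))

/-- There is an isomorphism `η` of the (undirected) generator with `η ∘ φ₋ = φ₊` and
`η ∘ φ₊ = φ₋`. -/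
def IsSymmetric : Prop := ∃ (η : S.gen.V ≃ S.gen.V) (ηE : S.gen.E ≃ S.gen.E),
  (∀ e : S.gen.E, S.gen.ends (ηE e) = Sym2.map η (S.gen.ends e)) ∧
  ∀ (s : Bool) (i : S.I), η (S.φ s i) = S.φ (!s) i

/-- The identifications `(φ_{v,e}(i), e) ∼ (φ_{v,f}(i), f)` on `V₁ × E` for a graph `G` with edge
set `E`, whenever `v` is a common endpoint of the edges `e`, `f` of `G`. -/
inductive GlueRel (G : LabelledGraph.{u}) : S.gen.V × G.E → S.gen.V × G.E → Prop
  | glue (s t : Bool) (e f : G.E) (i : S.I) (h : G.endpt s e = G.endpt t f) :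
      GlueRel G (S.φ s i, e) (S.φ t i, f)

/-- Replace every edge of `G` by a copy of the generator and glue: the vertex set is
`(V₁ × E) / ∼`, the edge set is `E₁ × E`, and the endpoints of `(e, f)` are `[e⁻, f]`, `[e⁺, f]`. -/
def replace (G : LabelledGraph.{u}) : LabelledGraph.{u} where
  V := Quot (S.GlueRel G)
  E := S.gen.E × G.E
  endpt s p := Quot.mk _ (S.gen.endpt s p.1, p.2)

/-- The replacement graphs.  Levels are counted from zero: `S.graph n` is the graph usually
denoted by `G_{n+1}`, and `S.graph 0` is the generator. -/
def graph : ℕ → LabelledGraph.{u}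
  | 0 => S.gen
  | n + 1 => S.replace (graph n)

/-- The projection `π(e, f) = f` from the edges of one level to those of the previous level. -/
def parent {n : ℕ} (e : (S.graph (n + 1)).E) : (S.graph n).E := Prod.snd e

/-- The edge `g` of level `n` lies in the subgraph covered by the collection `Ω` of edges: it is a
descendant (under iterated replacement) of some edge belonging to `Ω`, or belongs to `Ω` itself. -/
def Covered (Ω : Finset (Σ n : ℕ, (S.graph n).E)) : (n : ℕ) → (S.graph n).E → Prop
  | 0, g => ⟨0, g⟩ ∈ Ω
  | n + 1, g => ⟨n + 1, g⟩ ∈ Ω ∨ Covered Ω n (S.parent g)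

/-- The multiplicative cascade of densities induced by a density `ρ` on the generator. -/
def cascade (ρ : S.gen.E → ℝ) : (n : ℕ) → (S.graph n).E → ℝ
  | 0, e => ρ e
  | n + 1, e => cascade ρ n (S.parent e) * ρ (Prod.fst e)

/-- The collections `Ω` of edges of level at most `n` such that `v` and `w` are connected by a path
in the subgraph of `S.graph n` covered by `Ω`. -/
def chains (n : ℕ) (v w : (S.graph n).V) : Set (Finset (Σ k : ℕ, (S.graph k).E)) :=
  {Ω | (∀ e ∈ Ω, e.1 ≤ n) ∧
    ∃ l : List (S.graph n).E, (S.graph n).IsPath v l w ∧ ∀ g ∈ l, S.Covered Ω n g}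

open Classical in
/-- The metric `d_{ρ,n}` on the vertices of level `n`. -/
noncomputable def vertexDist (ρ : S.gen.E → ℝ) (n : ℕ) (v w : (S.graph n).V) : ℝ :=
  if v = w then 0
  else sInf ((fun Ω : Finset (Σ k : ℕ, (S.graph k).E) => ∑ e ∈ Ω, S.cascade ρ e.1 e.2) ''
    S.chains n v w)

/-- `d_{ρ,n}(e, f)`, the minimum of `d_{ρ,n}(v, w)` over the endpoints `v` of `e` and `w` of `f`. -/
noncomputable def edgeDist (ρ : S.gen.E → ℝ) (n : ℕ) (e f : (S.graph n).E) : ℝ :=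
  ⨅ p : Bool × Bool, S.vertexDist ρ n ((S.graph n).endpt p.1 e) ((S.graph n).endpt p.2 f)

/-- The symbol space: sequences of edges, one of each level, compatible with the projections. -/
def Symbol : Type u :=
  {e : (n : ℕ) → (S.graph n).E // ∀ n : ℕ, S.parent (e (n + 1)) = e n}

/-- Two symbols are identified when their edges share an endpoint at every level. -/
def SymbolRel (x y : S.Symbol) : Prop := ∀ n : ℕ, (S.graph n).Meets (x.1 n) (y.1 n)

/-- The limit space. -/
def LimitSpace : Type u := Quot S.SymbolRel

/-- `L_*`, the path distance in the generator between `I₋` and `I₊`. -/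
noncomputable def Lstar : ℕ :=
  sInf {k : ℕ | ∃ (i j : S.I) (l : List S.gen.E),
    S.gen.IsPath (S.φ false i) l (S.φ true j) ∧ l.length = k}

/-- `M` is the metric `d_ρ` on the limit space:
`d_ρ([(e_n)], [(f_n)]) = lim_n d_{ρ,n}(e_n, f_n)` for all symbols `(e_n)`, `(f_n)`. -/
def IsLimitMetric (ρ : S.gen.E → ℝ) (M : MetricSpace S.LimitSpace) : Prop :=
  ∀ x y : S.Symbol, Tendsto (fun n : ℕ => S.edgeDist ρ n (x.1 n) (y.1 n)) atTop
    (𝓝 (M.dist (Quot.mk S.SymbolRel x) (Quot.mk S.SymbolRel y)))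

/-- `M` is the intrinsic metric `d_{L_*}`, given by the constant density `1 / L_*`. -/
def IsIntrinsicMetric (M : MetricSpace S.LimitSpace) : Prop :=
  S.IsLimitMetric (fun _ => (S.Lstar : ℝ)⁻¹) M

end SimpleIGS

/-- Approximate self-similarity: for some `L > 1`, every rescaled ball `(B(x,r), d/r)` with
`0 < r ≤ diam X` is mapped by an `L`-bi-Lipschitz map onto an open subset of `X`. -/
def ApproximatelySelfSimilar (X : Type u) [MetricSpace X] : Prop :=
  ∃ L : ℝ, 1 < L ∧ ∀ (x : X) (r : ℝ), 0 < r → ENNReal.ofReal r ≤ Metric.ediam (Set.univ : Set X) →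
    ∃ (U : Set X) (f : Metric.ball x r → X), IsOpen U ∧ Set.range f = U ∧
      ∀ y z : Metric.ball x r,
        L⁻¹ * (dist y z / r) ≤ dist (f y) (f z) ∧ dist (f y) (f z) ≤ L * (dist y z / r)

/-!
The metric of the limit space is, up to a constant factor, combinatorial. Count levels from zero and
write `λ = 1 / L_*`, so that `λ ≤ 1/2` by non-degeneracy. If `n` is the last level at which the
edges `x_n`, `y_n` of two symbols share a vertex, then `d(x, y)` is comparable to `λ ^ n`.

* Upper bound (`limitDist_le`): adding `x_n` and `y_n` to a collection that connects them at level
  `n` gives a connection at every later level (`Joined.lift`). Hence `d_n(x_n, y_n)` is almost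
  non-increasing. So the limit exists, and it is at most `2 λ ^ (n + 1)` if `x_n` meets `y_n`.
* Lower bound (`le_limitDist`): if `x_n`, `y_n` are disjoint, take a function on the vertices of
  level `n` that vanishes on `x_n` and equals `λ ^ (n + 1)` elsewhere, and extend it to later levels
  by interpolating with the truncated distance to `I₋` in each copy of the generator. It oscillates
  on the descendants of an edge of level `k` by at most the weight `λ ^ (k + 1)` of this edge. Hence
  every collection of edges that connects `x_m` to `y_m` has weight at least `λ ^ (n + 1)`.

In particular `d(x, y) = 0` if and only if `x ∼ y`. Transitivity of `∼` holds because an edge of the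
generator cannot reach both `I₋` and `I₊`.

For approximate self-similarity it is now enough to map a ball into the limit space in such a way
that the levels at which symbols meet are shifted by a constant. A ball of radius about `λ ^ n` lies
in the star of a vertex `v` of level `n`, and stays away from the outer ends of this star
(`exists_nearCentre`). By doubling, the star of `v` is isomorphic to the star of a vertex of the
generator, up to the labels of the endpoints (`exists_starIso`). The symmetry `η` corrects the
labels: below an edge whose labels are reversed, the letters of a symbol are replaced by their
images under `η`, and whether `η` exchanges the labels of such a letter decides how the next letter
is treated (`Twist.word`). Near the centre of the star the resulting map `StarIso.map` preserves all
coincidences of endpoints (`meetsAt_map_iff`). Its image is open since points close to the image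
again pass through the target star, and all of the target star is attained (`exists_map_eq`).
-/

namespace SimpleIGS

variable {S : SimpleIGS.{u, w}}

/-! ### Coincidences of endpoints in replacement graphs -/

/-- The images of `φ₋` and `φ₊` are disjoint and both maps are injective. -/
theorem φ_eq_iff {s t : Bool} {i j : S.I} : S.φ s i = S.φ t j ↔ s = t ∧ i = j := by
  refine ⟨fun h => ?_, by rintro ⟨rfl, rfl⟩; rfl⟩
  have key : ∀ i j, S.φ false i ≠ S.φ true j := fun i j h =>
    Set.disjoint_left.1 S.disjoint_ranges ⟨i, rfl⟩ ⟨j, h.symm⟩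
  rcases s with _ | _ <;> rcases t with _ | _
  · exact ⟨rfl, S.φ_injective _ h⟩
  · exact absurd h (key _ _)
  · exact absurd h.symm (key _ _)
  · exact ⟨rfl, S.φ_injective _ h⟩

/-- The gluing relation is already transitive, so that two pairs define the same vertex only if
they are equal or glued directly. -/
theorem replace_mk_eq_iff (G : LabelledGraph.{u}) {v v' : S.gen.V} {e e' : G.E} :
    (Quot.mk (S.GlueRel G) (v, e) = Quot.mk (S.GlueRel G) (v', e')) ↔
      (v = v' ∧ e = e') ∨
        ∃ s t i, v = S.φ s i ∧ v' = S.φ t i ∧ G.endpt s e = G.endpt t e' := by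
  constructor
  · intro h
    have h' := Quot.eqvGen_exact h
    have key : ∀ p q : S.gen.V × G.E, Relation.EqvGen (S.GlueRel G) p q → p = q ∨
        ∃ s t i, p.1 = S.φ s i ∧ q.1 = S.φ t i ∧ G.endpt s p.2 = G.endpt t q.2 := by
      intro p q hpq
      induction hpq with
      | rel p q h =>
        cases h with
        | glue s t e f i h => exact Or.inr ⟨s, t, i, rfl, rfl, h⟩
      | refl p => exact Or.inl rfl
      | symm p q _ ih =>
        rcases ih with rfl | ⟨s, t, i, h1, h2, h3⟩
        · exact Or.inl rfl
        · exact Or.inr ⟨t, s, i, h2, h1, h3.symm⟩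
      | trans p q r _ _ ih1 ih2 =>
        rcases ih1 with rfl | ⟨s, t, i, h1, h2, h3⟩
        · exact ih2
        rcases ih2 with rfl | ⟨s', t', j, h1', h2', h3'⟩
        · exact Or.inr ⟨s, t, i, h1, h2, h3⟩
        · obtain ⟨rfl, rfl⟩ := φ_eq_iff.1 (h2.symm.trans h1')
          exact Or.inr ⟨s, t', i, h1, h2', h3.trans h3'⟩
    rcases key _ _ h' with h | h
    · exact Or.inl (Prod.mk.inj h)
    · exact Or.inr h
  · rintro (⟨rfl, rfl⟩ | ⟨s, t, i, rfl, rfl, h⟩)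
    · rfl
    · exact Quot.sound (GlueRel.glue s t e e' i h)

theorem gen_endpt_inj {e : S.gen.E} {a b : Bool} (h : S.gen.endpt a e = S.gen.endpt b e) :
    a = b := by
  rcases a with _ | _ <;> rcases b with _ | _
  · rfl
  · exact absurd h (S.no_loops e)
  · exact absurd h.symm (S.no_loops e)
  · rfl

/-- No replacement graph has loops. -/
theorem endpt_inj : ∀ {n : ℕ} {e : (S.graph n).E} {a b : Bool},
    (S.graph n).endpt a e = (S.graph n).endpt b e → a = b
  | 0, _, _, _, h => gen_endpt_inj h
  | n + 1, (g, p), a, b, h => by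
    rcases (replace_mk_eq_iff (S.graph n)).1 h with ⟨h, -⟩ | ⟨s, t, i, h1, h2, h3⟩
    · exact gen_endpt_inj h
    · obtain rfl := endpt_inj h3
      exact gen_endpt_inj (h1.trans h2.symm)

/-- An edge of a non-degenerate generator has at most one endpoint in `I₋ ∪ I₊`. -/
theorem IsNonDegenerate.endpt_unique (hn : S.IsNonDegenerate) {g : S.gen.E} {a b s t : Bool}
    {i j : S.I} (h1 : S.gen.endpt a g = S.φ s i) (h2 : S.gen.endpt b g = S.φ t j) :
    a = b ∧ s = t ∧ i = j := by
  have hab : a = b := by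
    by_contra hne
    have key : ∀ (s t : Bool) (i j : S.I), S.gen.endpt false g = S.φ s i →
        S.gen.endpt true g = S.φ t j → False := by
      intro s t i j h1 h2
      by_cases hst : t = s
      · subst hst
        exact S.no_edge_in_range t g ⟨⟨i, h1.symm⟩, ⟨j, h2.symm⟩⟩
      · obtain rfl : t = !s := by cases s <;> cases t <;> simp_all
        exact hn s g ⟨⟨i, h1.symm⟩, ⟨j, h2.symm⟩⟩
    rcases a with _ | _ <;> rcases b with _ | _
    · exact hne rfl
    · exact key _ _ _ _ h1 h2
    · exact key _ _ _ _ h2 h1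
    · exact hne rfl
  subst hab
  exact ⟨rfl, φ_eq_iff.1 (h1.symm.trans h2)⟩

theorem _root_.LabelledGraph.mem_ends {G : LabelledGraph.{u}} {e : G.E} {v : G.V} :
    v ∈ G.ends e ↔ ∃ a, G.endpt a e = v := by
  simp [LabelledGraph.ends, eq_comm]

theorem _root_.LabelledGraph.meets_iff {G : LabelledGraph.{u}} {e f : G.E} :
    G.Meets e f ↔ ∃ a b, G.endpt a e = G.endpt b f := by
  simp only [LabelledGraph.Meets, LabelledGraph.mem_ends]
  constructor
  · rintro ⟨v, ⟨a, rfl⟩, b, hb⟩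
    exact ⟨a, b, hb.symm⟩
  · rintro ⟨a, b, h⟩
    exact ⟨_, ⟨a, rfl⟩, b, h.symm⟩

/-! ### Symbols as infinite words -/

/-- The edge of level `n` of a symbol. -/
def Symbol.edge (x : S.Symbol) (n : ℕ) : (S.graph n).E := x.1 n

/-- The `k`-th letter of a symbol: the edge of the generator chosen at the `k`-th replacement. -/
def Symbol.letter (x : S.Symbol) : ℕ → S.gen.E
  | 0 => x.1 0
  | k + 1 => Prod.fst (x.1 (k + 1))

theorem Symbol.endpt_succ (x : S.Symbol) (k : ℕ) (a : Bool) :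
    (S.graph (k + 1)).endpt a (x.edge (k + 1)) =
      Quot.mk (S.GlueRel (S.graph k)) (S.gen.endpt a (x.letter (k + 1)), x.edge k) := by
  unfold edge; rw [← x.2 k]; rfl

theorem Symbol.edge_succ (x : S.Symbol) (k : ℕ) :
    x.edge (k + 1) = ((x.letter (k + 1), x.edge k) : S.gen.E × (S.graph k).E) := by
  unfold edge; rw [← x.2 k]; rfl

theorem Symbol.edge_succ_eq_iff (x y : S.Symbol) (k : ℕ) :
    x.edge (k + 1) = y.edge (k + 1) ↔
      x.letter (k + 1) = y.letter (k + 1) ∧ x.edge k = y.edge k := by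
  rw [edge_succ, edge_succ]; exact Prod.mk_inj

/-- The recursion for coincidences of endpoints along two symbols. -/
theorem Symbol.endpt_succ_eq_iff (x y : S.Symbol) (k : ℕ) (a b : Bool) :
    (S.graph (k + 1)).endpt a (x.edge (k + 1)) = (S.graph (k + 1)).endpt b (y.edge (k + 1)) ↔
      (x.edge k = y.edge k ∧ S.gen.endpt a (x.letter (k + 1)) = S.gen.endpt b (y.letter (k + 1))) ∨
        ∃ s t i, (S.graph k).endpt s (x.edge k) = (S.graph k).endpt t (y.edge k) ∧
          S.gen.endpt a (x.letter (k + 1)) = S.φ s i ∧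
          S.gen.endpt b (y.letter (k + 1)) = S.φ t i := by
  rw [endpt_succ, endpt_succ]
  refine (replace_mk_eq_iff (S.graph k)).trans <| or_congr and_comm <|
    exists_congr fun s => exists_congr fun t => exists_congr fun i => ?_
  tauto

/-- The symbols `x` and `y` have a common vertex at level `n`. -/
def Symbol.MeetsAt (x y : S.Symbol) (n : ℕ) : Prop :=
  ∃ a b, (S.graph n).endpt a (x.edge n) = (S.graph n).endpt b (y.edge n)

theorem symbolRel_iff {x y : S.Symbol} : S.SymbolRel x y ↔ ∀ n, x.MeetsAt y n :=
  forall_congr' fun _ => LabelledGraph.meets_iff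

theorem Symbol.MeetsAt.symm {x y : S.Symbol} {n : ℕ} (h : x.MeetsAt y n) : y.MeetsAt x n := by
  obtain ⟨a, b, h⟩ := h
  exact ⟨b, a, h.symm⟩

theorem Symbol.MeetsAt.of_succ {x y : S.Symbol} {n : ℕ} (h : x.MeetsAt y (n + 1)) :
    x.MeetsAt y n := by
  obtain ⟨a, b, h⟩ := h
  rcases (Symbol.endpt_succ_eq_iff x y n a b).1 h with ⟨h, -⟩ | ⟨s, t, i, h, -, -⟩
  · exact ⟨true, true, by rw [h]⟩
  · exact ⟨s, t, h⟩

theorem Symbol.MeetsAt.mono {x y : S.Symbol} {m n : ℕ} (h : x.MeetsAt y n) (hmn : m ≤ n) :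
    x.MeetsAt y m := by
  induction hmn using Nat.decreasingInduction with
  | self => exact h
  | of_succ k _ ih => exact ih.of_succ

/-- If `x`, `z` both touch `y` at level `n + 1`, then they touch it, at level `n`, in the same
vertex, because an edge of the generator cannot reach both ends of the edge of `y`. -/
theorem Symbol.MeetsAt.trans_succ (hn : S.IsNonDegenerate) {x y z : S.Symbol} {n : ℕ}
    (hxy : x.MeetsAt y (n + 1)) (hyz : y.MeetsAt z (n + 1)) : x.MeetsAt z n := by
  obtain ⟨a, b, h1⟩ := hxy
  obtain ⟨c, d, h2⟩ := hyz
  rcases (Symbol.endpt_succ_eq_iff x y n a b).1 h1 with ⟨h, -⟩ | ⟨s, t, i, h, -, h'⟩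
  · obtain ⟨c, d, h2⟩ := Symbol.MeetsAt.of_succ ⟨c, d, h2⟩
    exact ⟨c, d, by rw [h, h2]⟩
  rcases (Symbol.endpt_succ_eq_iff y z n c d).1 h2 with ⟨k, -⟩ | ⟨s', t', j, k, k', -⟩
  · exact ⟨s, t, by rw [h, k]⟩
  obtain ⟨-, rfl, -⟩ := hn.endpt_unique h' k'
  exact ⟨s, t', h.trans k⟩

theorem symbolRel_equivalence (hn : S.IsNonDegenerate) : Equivalence S.SymbolRel where
  refl _ := symbolRel_iff.2 fun _ => ⟨true, true, rfl⟩
  symm h := symbolRel_iff.2 fun n => (symbolRel_iff.1 h n).symm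
  trans h h' := symbolRel_iff.2 fun n =>
    (symbolRel_iff.1 h (n + 1)).trans_succ hn (symbolRel_iff.1 h' (n + 1))

/-! ### Connections through collections of edges -/

variable (S) in
/-- The vertices `v`, `w` of level `n` are joined by a path in the subgraph covered by `Ω`. -/
def Joined (Ω : Finset (Σ k : ℕ, (S.graph k).E)) (n : ℕ) (v w : (S.graph n).V) : Prop :=
  ∃ l : List (S.graph n).E, (S.graph n).IsPath v l w ∧ ∀ g ∈ l, S.Covered Ω n g

theorem _root_.LabelledGraph.ends_eq_mk_iff {G : LabelledGraph.{u}} {e : G.E} {v w : G.V} :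
    G.ends e = s(v, w) ↔ ∃ a, G.endpt a e = v ∧ G.endpt (!a) e = w := by
  simp only [LabelledGraph.ends, Sym2.eq_iff, Bool.exists_bool, Bool.not_false, Bool.not_true]
  tauto

namespace Joined

variable {Ω : Finset (Σ k : ℕ, (S.graph k).E)} {n : ℕ} {v v' v'' : (S.graph n).V}

theorem refl (v : (S.graph n).V) : S.Joined Ω n v v := ⟨[], rfl, by simp⟩

theorem cons {g : (S.graph n).E} (hg : S.Covered Ω n g) (a : Bool)
    (h : S.Joined Ω n ((S.graph n).endpt (!a) g) v) :
    S.Joined Ω n ((S.graph n).endpt a g) v := by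
  obtain ⟨l, hl, hc⟩ := h
  exact ⟨g :: l, ⟨_, LabelledGraph.ends_eq_mk_iff.2 ⟨a, rfl, rfl⟩, hl⟩, by simpa using ⟨hg, hc⟩⟩

/-- Being joined is the least reflexive and transitive relation that relates the endpoints of
every covered edge, in either order. -/
theorem induction {R : (S.graph n).V → (S.graph n).V → Prop} (hrefl : ∀ v, R v v)
    (hcons : ∀ g a w, S.Covered Ω n g → R ((S.graph n).endpt (!a) g) w →
      R ((S.graph n).endpt a g) w)
    (h : S.Joined Ω n v v') : R v v' := by
  obtain ⟨l, hl, hc⟩ := h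
  induction l generalizing v with
  | nil => exact (show v = v' from hl) ▸ hrefl v
  | cons e l ih =>
    obtain ⟨u, hu, hl⟩ := hl
    obtain ⟨a, rfl, rfl⟩ := LabelledGraph.ends_eq_mk_iff.1 hu
    exact hcons _ _ _ (hc e (by simp)) (ih hl fun g hg => hc g (by simp [hg]))

theorem trans (h : S.Joined Ω n v v') (h' : S.Joined Ω n v' v'') : S.Joined Ω n v v'' :=
  induction (R := fun v v' => ∀ v'', S.Joined Ω n v' v'' → S.Joined Ω n v v'')
    (fun _ _ h => h) (fun _ a _ hg ih _ h => cons hg a (ih _ h)) h _ h'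

theorem of_covered {g : (S.graph n).E} (hg : S.Covered Ω n g) (a b : Bool) :
    S.Joined Ω n ((S.graph n).endpt a g) ((S.graph n).endpt b g) := by
  by_cases h : b = a
  · subst h; exact refl _
  · obtain rfl : b = !a := by cases a <;> cases b <;> simp_all
    exact cons hg a (refl _)

theorem symm (h : S.Joined Ω n v v') : S.Joined Ω n v' v :=
  induction (R := fun v v' => S.Joined Ω n v' v) refl
    (fun _ a _ hg ih => ih.trans (of_covered hg (!a) a)) h

end Joined

theorem Covered.mono {Ω Ω' : Finset (Σ k : ℕ, (S.graph k).E)} (h : Ω ⊆ Ω') :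
    ∀ {n : ℕ} {g : (S.graph n).E}, S.Covered Ω n g → S.Covered Ω' n g
  | 0, _, hg => h hg
  | _ + 1, _, hg => hg.imp (fun hg => h hg) (Covered.mono h)

theorem Joined.mono {Ω Ω' : Finset (Σ k : ℕ, (S.graph k).E)} (h : Ω ⊆ Ω') {n : ℕ}
    {v v' : (S.graph n).V} (hj : S.Joined Ω n v v') : S.Joined Ω' n v v' := by
  obtain ⟨l, hl, hc⟩ := hj
  exact ⟨l, hl, fun g hg => (hc g hg).mono h⟩

theorem covered_of_mem {Ω : Finset (Σ k : ℕ, (S.graph k).E)} {n : ℕ} {g : (S.graph n).E}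
    (h : ⟨n, g⟩ ∈ Ω) : S.Covered Ω n g := by
  cases n with
  | zero => exact h
  | succ n => exact Or.inl h

theorem Symbol.covered_succ {Ω : Finset (Σ k : ℕ, (S.graph k).E)} {n : ℕ} {x : S.Symbol}
    (h : S.Covered Ω n (x.edge n)) : S.Covered Ω (n + 1) (x.edge (n + 1)) := by
  refine Or.inr ?_
  rw [Symbol.edge, x.2 n]
  exact h

/-- The copy of the connected generator that replaces a covered edge is covered. -/
theorem Joined.of_covered_parent {Ω : Finset (Σ k : ℕ, (S.graph k).E)} {n : ℕ}
    {p : (S.graph n).E} (hp : S.Covered Ω n p) (v w : S.gen.V) :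
    S.Joined Ω (n + 1) (Quot.mk (S.GlueRel (S.graph n)) (v, p))
      (Quot.mk (S.GlueRel (S.graph n)) (w, p)) := by
  obtain ⟨l, hl⟩ := S.connected v w
  induction l generalizing v with
  | nil => exact (show v = w from hl) ▸ Joined.refl _
  | cons e l ih =>
    obtain ⟨u, hu, hl⟩ := hl
    obtain ⟨a, rfl, rfl⟩ := LabelledGraph.ends_eq_mk_iff.1 hu
    exact Joined.cons (S := S) (n := n + 1) (g := ((e, p) : S.gen.E × (S.graph n).E))
      (Or.inr hp) a (ih _ hl)

/-- A connection between two covered edges persists at the next level. -/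
theorem Joined.lift {Ω : Finset (Σ k : ℕ, (S.graph k).E)} {n : ℕ} {p q : (S.graph n).E}
    (hp : S.Covered Ω n p) (hq : S.Covered Ω n q) {a b : Bool}
    (h : S.Joined Ω n ((S.graph n).endpt a p) ((S.graph n).endpt b q)) (v w : S.gen.V) :
    S.Joined Ω (n + 1) (Quot.mk (S.GlueRel (S.graph n)) (v, p))
      (Quot.mk (S.GlueRel (S.graph n)) (w, q)) := by
  obtain ⟨i⟩ := S.nonempty_I
  have glue : ∀ (p q : (S.graph n).E) (a b : Bool), S.Covered Ω n p → S.Covered Ω n q →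
      (S.graph n).endpt a p = (S.graph n).endpt b q → ∀ v w : S.gen.V,
      S.Joined Ω (n + 1) (Quot.mk (S.GlueRel (S.graph n)) (v, p))
        (Quot.mk (S.GlueRel (S.graph n)) (w, q)) := by
    intro p q a b hp hq h v w
    refine (of_covered_parent hp v (S.φ a i)).trans ?_
    rw [Quot.sound (GlueRel.glue a b p q i h)]
    exact of_covered_parent hq _ w
  refine Joined.induction (R := fun x y => ∀ (p q : (S.graph n).E) (a b : Bool),
    S.Covered Ω n p → S.Covered Ω n q → (S.graph n).endpt a p = x →
    (S.graph n).endpt b q = y → ∀ v w : S.gen.V,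
    S.Joined Ω (n + 1) (Quot.mk (S.GlueRel (S.graph n)) (v, p))
      (Quot.mk (S.GlueRel (S.graph n)) (w, q))) ?_ ?_ h p q a b hp hq rfl rfl v w
  · intro x p q a b hp hq hpx hqx
    exact glue p q a b hp hq (hpx.trans hqx.symm)
  · intro g c y hg ih p q a b hp hq hpx hqy v w
    exact (glue p g a c hp hg hpx v v).trans (ih g q _ b hg hq rfl hqy v w)

/-- A connection between the edges of two symbols persists at all later levels. -/
theorem Symbol.joined_of_le {Ω : Finset (Σ k : ℕ, (S.graph k).E)} {x y : S.Symbol} {n m : ℕ}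
    (hnm : n ≤ m) (hx : S.Covered Ω n (x.edge n)) (hy : S.Covered Ω n (y.edge n))
    (h : ∃ a b, S.Joined Ω n ((S.graph n).endpt a (x.edge n)) ((S.graph n).endpt b (y.edge n))) :
    S.Covered Ω m (x.edge m) ∧ S.Covered Ω m (y.edge m) ∧
      ∃ a b, S.Joined Ω m ((S.graph m).endpt a (x.edge m)) ((S.graph m).endpt b (y.edge m)) := by
  induction m, hnm using Nat.le_induction with
  | base => exact ⟨hx, hy, h⟩
  | succ m _ ih =>
    obtain ⟨hx, hy, a, b, h⟩ := ih
    refine ⟨Symbol.covered_succ hx, Symbol.covered_succ hy, a, b, ?_⟩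
    rw [Symbol.endpt_succ, Symbol.endpt_succ]
    exact Joined.lift hx hy h _ _

variable (S) in
/-- The collection of all edges of the generator. -/
noncomputable def genEdges : Finset (Σ k : ℕ, (S.graph k).E) :=
  haveI := S.finite_E
  (Set.toFinite (Set.range fun e : S.gen.E => (⟨0, e⟩ : Σ k : ℕ, (S.graph k).E))).toFinset

theorem mem_genEdges {e : Σ k : ℕ, (S.graph k).E} :
    e ∈ S.genEdges ↔ ∃ g : S.gen.E, ⟨0, g⟩ = e := by
  simp [genEdges]

theorem covered_genEdges : ∀ (n : ℕ) (g : (S.graph n).E), S.Covered S.genEdges n g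
  | 0, g => mem_genEdges.2 ⟨g, rfl⟩
  | n + 1, g => Or.inr (covered_genEdges n (S.parent g))

/-- All replacement graphs are connected. -/
theorem joined_genEdges (n : ℕ) (v w : (S.graph n).V) : S.Joined S.genEdges n v w := by
  induction n with
  | zero =>
    obtain ⟨l, hl⟩ := S.connected v w
    exact ⟨l, hl, fun g _ => covered_genEdges 0 g⟩
  | succ n ih =>
    obtain ⟨v, p⟩ := v
    obtain ⟨w, q⟩ := w
    exact Joined.lift (covered_genEdges n p) (covered_genEdges n q)
      (ih ((S.graph n).endpt true p) ((S.graph n).endpt true q)) v w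

/-! ### The distances at finite levels -/

variable (S) in
/-- The contraction ratio `1 / L_*`. -/
noncomputable def ratio : ℝ := (S.Lstar : ℝ)⁻¹

/-- The path distance between `I₋` and `I₊` is at least two, since no edge joins them. -/
theorem IsNonDegenerate.two_le_Lstar (hn : S.IsNonDegenerate) : 2 ≤ S.Lstar := by
  obtain ⟨i⟩ := S.nonempty_I
  obtain ⟨l, hl⟩ := S.connected (S.φ false i) (S.φ true i)
  have hne : {k : ℕ | ∃ (i j : S.I) (l : List S.gen.E),
    S.gen.IsPath (S.φ false i) l (S.φ true j) ∧ l.length = k}.Nonempty :=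
    ⟨_, i, i, l, hl, rfl⟩
  obtain ⟨i, j, l, hl, hk⟩ := Nat.sInf_mem hne
  change l.length = S.Lstar at hk
  rw [← hk]
  match l, hl with
  | [], h => exact absurd (φ_eq_iff.1 h).1 (by simp)
  | [e], h =>
    obtain ⟨v, hv, rfl⟩ := h
    obtain ⟨a, h1, h2⟩ := LabelledGraph.ends_eq_mk_iff.1 hv
    exact absurd (hn.endpt_unique h1 h2).2.1 (by simp)
  | _ :: _ :: _, _ => simp

theorem IsNonDegenerate.ratio_pos (hn : S.IsNonDegenerate) : 0 < S.ratio := by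
  have := hn.two_le_Lstar
  exact inv_pos.2 (by exact_mod_cast (by omega : 0 < S.Lstar))

theorem IsNonDegenerate.ratio_le_half (hn : S.IsNonDegenerate) : S.ratio ≤ 1 / 2 := by
  rw [ratio, one_div]
  exact inv_anti₀ two_pos (by exact_mod_cast hn.two_le_Lstar)

theorem IsNonDegenerate.ratio_le_one (hn : S.IsNonDegenerate) : S.ratio ≤ 1 :=
  hn.ratio_le_half.trans (by norm_num)

theorem cascade_const (c : ℝ) : ∀ (n : ℕ) (e : (S.graph n).E),
    S.cascade (fun _ => c) n e = c ^ (n + 1)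
  | 0, _ => by simp [cascade]
  | n + 1, e => by rw [cascade, cascade_const c n, pow_succ c (n + 1)]

/-- The total weight of a collection of edges for the constant density `1 / L_*`. -/
noncomputable def weight (Ω : Finset (Σ k : ℕ, (S.graph k).E)) : ℝ :=
  ∑ e ∈ Ω, S.ratio ^ (e.1 + 1)

theorem IsNonDegenerate.weight_nonneg (hn : S.IsNonDegenerate)
    (Ω : Finset (Σ k : ℕ, (S.graph k).E)) : 0 ≤ weight Ω :=
  Finset.sum_nonneg fun _ _ => pow_nonneg hn.ratio_pos.le _

open Classical in
theorem IsNonDegenerate.weight_union_le (hn : S.IsNonDegenerate)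
    (Ω Ω' : Finset (Σ k : ℕ, (S.graph k).E)) : weight (Ω ∪ Ω') ≤ weight Ω + weight Ω' := by
  have := Finset.sum_union_inter (s₁ := Ω) (s₂ := Ω')
    (f := fun e : Σ k : ℕ, (S.graph k).E => S.ratio ^ (e.1 + 1))
  have h := hn.weight_nonneg (Ω ∩ Ω')
  unfold weight at *
  linarith

open Classical in
theorem IsNonDegenerate.weight_insert_le (hn : S.IsNonDegenerate)
    (Ω : Finset (Σ k : ℕ, (S.graph k).E)) (n : ℕ) (e : (S.graph n).E) :
    weight (insert ⟨n, e⟩ Ω) ≤ weight Ω + S.ratio ^ (n + 1) := by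
  have := hn.weight_union_le {⟨n, e⟩} Ω
  rw [Finset.insert_eq]
  simp only [weight, Finset.sum_singleton] at *
  linarith

/-- The distance `d_n(x_n, y_n)` of the level-`n` edges of two symbols. -/
noncomputable def Symbol.levelDist (x y : S.Symbol) (n : ℕ) : ℝ :=
  S.edgeDist (fun _ => S.ratio) n (x.edge n) (y.edge n)

theorem sum_cascade_eq_weight (Ω : Finset (Σ k : ℕ, (S.graph k).E)) :
    ∑ e ∈ Ω, S.cascade (fun _ => S.ratio) e.1 e.2 = weight Ω :=
  Finset.sum_congr rfl fun _ _ => cascade_const _ _ _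

theorem IsNonDegenerate.vertexDist_nonneg (hn : S.IsNonDegenerate) (n : ℕ)
    (v w : (S.graph n).V) : 0 ≤ S.vertexDist (fun _ => S.ratio) n v w := by
  unfold vertexDist
  split_ifs
  · exact le_rfl
  · refine Real.sInf_nonneg ?_
    rintro _ ⟨Ω, -, rfl⟩
    exact (hn.weight_nonneg Ω).trans_eq (sum_cascade_eq_weight Ω).symm

theorem IsNonDegenerate.vertexDist_le (hn : S.IsNonDegenerate) {n : ℕ}
    {v w : (S.graph n).V} {Ω : Finset (Σ k : ℕ, (S.graph k).E)} (hΩ : ∀ e ∈ Ω, e.1 ≤ n)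
    (h : S.Joined Ω n v w) : S.vertexDist (fun _ => S.ratio) n v w ≤ weight Ω := by
  unfold vertexDist
  split_ifs
  · exact hn.weight_nonneg Ω
  · refine csInf_le ⟨0, ?_⟩ ⟨Ω, ⟨hΩ, h⟩, sum_cascade_eq_weight Ω⟩
    rintro _ ⟨Ω, -, rfl⟩
    exact (hn.weight_nonneg Ω).trans_eq (sum_cascade_eq_weight Ω).symm

theorem exists_weight_lt_of_vertexDist_lt {n : ℕ} {v w : (S.graph n).V} {c : ℝ}
    (h : S.vertexDist (fun _ => S.ratio) n v w < c) :
    ∃ Ω : Finset (Σ k : ℕ, (S.graph k).E),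
      (∀ e ∈ Ω, e.1 ≤ n) ∧ S.Joined Ω n v w ∧ weight Ω < c := by
  unfold vertexDist at h
  split_ifs at h with hvw
  · subst hvw
    exact ⟨∅, by simp, Joined.refl v, by simpa [weight] using h⟩
  · obtain ⟨_, ⟨Ω, hΩ, rfl⟩, hlt⟩ := exists_lt_of_csInf_lt (by
      refine ⟨_, S.genEdges, ⟨fun e he => ?_, joined_genEdges n v w⟩, rfl⟩
      obtain ⟨g, rfl⟩ := mem_genEdges.1 he
      exact Nat.zero_le n) h
    exact ⟨Ω, hΩ.1, hΩ.2, sum_cascade_eq_weight Ω ▸ hlt⟩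

theorem IsNonDegenerate.levelDist_le (hn : S.IsNonDegenerate) {x y : S.Symbol} {n : ℕ}
    {Ω : Finset (Σ k : ℕ, (S.graph k).E)} (hΩ : ∀ e ∈ Ω, e.1 ≤ n) {a b : Bool}
    (h : S.Joined Ω n ((S.graph n).endpt a (x.edge n)) ((S.graph n).endpt b (y.edge n))) :
    x.levelDist y n ≤ weight Ω :=
  (ciInf_le (Set.finite_range _).bddBelow (a, b)).trans (hn.vertexDist_le hΩ h)

theorem Symbol.exists_weight_lt {x y : S.Symbol} {n : ℕ} {c : ℝ} (h : x.levelDist y n < c) :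
    ∃ Ω : Finset (Σ k : ℕ, (S.graph k).E), (∀ e ∈ Ω, e.1 ≤ n) ∧ weight Ω < c ∧
      ∃ a b, S.Joined Ω n ((S.graph n).endpt a (x.edge n)) ((S.graph n).endpt b (y.edge n)) := by
  obtain ⟨⟨a, b⟩, hp⟩ := exists_eq_ciInf_of_finite (f := fun p : Bool × Bool =>
    S.vertexDist (fun _ => S.ratio) n ((S.graph n).endpt p.1 (x.edge n))
      ((S.graph n).endpt p.2 (y.edge n)))
  obtain ⟨Ω, h1, h2, h3⟩ := exists_weight_lt_of_vertexDist_lt (hp.trans_lt h)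
  exact ⟨Ω, h1, h3, a, b, h2⟩

theorem IsNonDegenerate.levelDist_nonneg (hn : S.IsNonDegenerate) (x y : S.Symbol) (n : ℕ) :
    0 ≤ x.levelDist y n :=
  Real.iInf_nonneg fun _ => hn.vertexDist_nonneg _ _ _

theorem IsNonDegenerate.levelDist_comm (hn : S.IsNonDegenerate) (x y : S.Symbol) (n : ℕ) :
    x.levelDist y n = y.levelDist x n := by
  have key : ∀ x y : S.Symbol, x.levelDist y n ≤ y.levelDist x n := fun x y =>
    le_of_forall_gt_imp_ge_of_dense fun c hc => by
      obtain ⟨Ω, h1, h2, a, b, h⟩ := Symbol.exists_weight_lt hc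
      exact (hn.levelDist_le h1 h.symm).trans h2.le
  exact le_antisymm (key _ _) (key _ _)

theorem IsNonDegenerate.levelDist_eq_zero (hn : S.IsNonDegenerate) {x y : S.Symbol} {n : ℕ}
    (h : x.MeetsAt y n) : x.levelDist y n = 0 := by
  refine le_antisymm ?_ (hn.levelDist_nonneg x y n)
  obtain ⟨a, b, h⟩ := h
  have hj : S.Joined ∅ n ((S.graph n).endpt a (x.edge n)) ((S.graph n).endpt b (y.edge n)) :=
    h ▸ Joined.refl _
  simpa [weight] using hn.levelDist_le (by simp) hj

open Classical in
/-- The triangle inequality holds at finite levels up to the cost of crossing one edge. -/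
theorem IsNonDegenerate.levelDist_triangle (hn : S.IsNonDegenerate) (x y z : S.Symbol) (n : ℕ) :
    x.levelDist z n ≤ x.levelDist y n + y.levelDist z n + S.ratio ^ (n + 1) := by
  refine le_of_forall_pos_le_add fun ε hε => ?_
  obtain ⟨Ω, h1, h2, a, b, h⟩ := Symbol.exists_weight_lt (x := x) (y := y) (n := n)
    (lt_add_of_pos_right _ (half_pos hε))
  obtain ⟨Ω', h1', h2', a', b', h'⟩ := Symbol.exists_weight_lt (x := y) (y := z) (n := n)
    (lt_add_of_pos_right _ (half_pos hε))
  have h3 := hn.levelDist_le (Ω := insert ⟨n, y.edge n⟩ (Ω ∪ Ω')) (x := x) (y := z) (n := n)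
    (a := a) (b := b') (fun e he => by
      rcases Finset.mem_insert.1 he with rfl | he
      · exact le_rfl
      · exact (Finset.mem_union.1 he).elim (h1 e) (h1' e))
    (((h.mono (by intro e; simp; tauto)).trans (Joined.of_covered
      (covered_of_mem (by simp)) b a')).trans (h'.mono (by intro e; simp; tauto)))
  have h4 := hn.weight_insert_le (Ω ∪ Ω') n (y.edge n)
  have h5 := hn.weight_union_le Ω Ω'
  linarith

open Classical in
/-- A connection of level `n`, with the two level-`n` edges themselves added, is a connection at all
later levels. -/
theorem IsNonDegenerate.levelDist_le_of_le (hn : S.IsNonDegenerate) (x y : S.Symbol) {n m : ℕ}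
    (hnm : n ≤ m) : x.levelDist y m ≤ x.levelDist y n + 2 * S.ratio ^ (n + 1) := by
  refine le_of_forall_pos_le_add fun ε hε => ?_
  obtain ⟨Ω, h1, h2, a, b, h⟩ := Symbol.exists_weight_lt (x := x) (y := y) (n := n)
    (lt_add_of_pos_right _ hε)
  obtain ⟨-, -, a', b', h'⟩ := Symbol.joined_of_le
    (Ω := insert ⟨n, x.edge n⟩ (insert ⟨n, y.edge n⟩ Ω)) hnm
    (covered_of_mem (by simp)) (covered_of_mem (by simp))
    ⟨a, b, h.mono (by intro e; simp; tauto)⟩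
  have h3 := hn.levelDist_le (fun e he => by
    rcases Finset.mem_insert.1 he with rfl | he
    · exact hnm
    rcases Finset.mem_insert.1 he with rfl | he
    · exact hnm
    exact (h1 e he).trans hnm) h'
  have h4 := hn.weight_insert_le (insert ⟨n, y.edge n⟩ Ω) n (x.edge n)
  have h5 := hn.weight_insert_le Ω n (y.edge n)
  linarith

theorem IsNonDegenerate.levelDist_le_weight_genEdges (hn : S.IsNonDegenerate) (x y : S.Symbol)
    (n : ℕ) : x.levelDist y n ≤ weight S.genEdges := by
  refine hn.levelDist_le (a := true) (b := true) (fun e he => ?_) (joined_genEdges _ _ _)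
  obtain ⟨g, rfl⟩ := mem_genEdges.1 he
  exact Nat.zero_le n

/-! ### The lower bound for separated edges -/

variable (S) in
/-- The vertex `v` is joined to `I₋` by a path of `k` edges in the generator. -/
def ReachedIn (v : S.gen.V) (k : ℕ) : Prop :=
  ∃ (i : S.I) (l : List S.gen.E), S.gen.IsPath (S.φ false i) l v ∧ l.length = k

theorem _root_.LabelledGraph.IsPath.concat {G : LabelledGraph.{u}} {v w : G.V} {l : List G.E}
    (h : G.IsPath v l w) {e : G.E} {w' : G.V} (he : G.ends e = s(w, w')) :
    G.IsPath v (l ++ [e]) w' := by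
  induction l generalizing v with
  | nil => exact ⟨w', (show v = w from h) ▸ he, rfl⟩
  | cons f l ih =>
    obtain ⟨u, hu, h⟩ := h
    exact ⟨u, hu, ih h⟩

/-- The generator carries a function with values in `[0, 1]` that vanishes on `I₋`, equals one on
`I₊` and varies by at most `1 / L_*` along every edge: the truncated distance to `I₋`. -/
theorem IsNonDegenerate.exists_potential (hn : S.IsNonDegenerate) : ∃ p : S.gen.V → ℝ,
    (∀ v, 0 ≤ p v ∧ p v ≤ 1) ∧ (∀ i, p (S.φ false i) = 0) ∧ (∀ i, p (S.φ true i) = 1) ∧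
    ∀ e a, p (S.gen.endpt a e) ≤ p (S.gen.endpt (!a) e) + S.ratio := by
  set δ : S.gen.V → ℕ := fun v => sInf {k | S.ReachedIn v k} with hδ
  have hL : (0 : ℝ) < S.Lstar := by exact_mod_cast zero_lt_two.trans_le hn.two_le_Lstar
  have hreach : ∀ v, S.ReachedIn v (δ v) := fun v => by
    obtain ⟨i⟩ := S.nonempty_I
    obtain ⟨l, hl⟩ := S.connected (S.φ false i) v
    exact Nat.sInf_mem (s := {k | S.ReachedIn v k}) ⟨_, i, l, hl, rfl⟩
  refine ⟨fun v => min 1 (δ v / S.Lstar), fun v => ⟨by positivity, min_le_left _ _⟩, fun i => ?_,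
    fun i => ?_, fun e a => ?_⟩
  · have : δ (S.φ false i) = 0 := Nat.le_zero.1 (Nat.sInf_le ⟨i, [], rfl, rfl⟩)
    simp [this]
  · have : S.Lstar ≤ δ (S.φ true i) := by
      obtain ⟨j, l, hl, hk⟩ := hreach (S.φ true i)
      exact Nat.sInf_le ⟨j, i, l, hl, hk⟩
    exact min_eq_left ((one_le_div hL).2 (by exact_mod_cast this))
  · have : δ (S.gen.endpt a e) ≤ δ (S.gen.endpt (!a) e) + 1 := by
      obtain ⟨j, l, hl, hk⟩ := hreach (S.gen.endpt (!a) e)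
      refine Nat.sInf_le ⟨j, l ++ [e], hl.concat
        (LabelledGraph.ends_eq_mk_iff.2 ⟨!a, rfl, by rw [Bool.not_not]⟩), by simp [hk]⟩
    have h' : (δ (S.gen.endpt a e) : ℝ) / S.Lstar ≤
        δ (S.gen.endpt (!a) e) / S.Lstar + S.ratio := by
      rw [ratio, inv_eq_one_div, ← add_div]
      gcongr
      exact_mod_cast this
    have := hn.ratio_pos
    change min 1 _ ≤ min 1 _ + _
    rcases le_total 1 ((δ (S.gen.endpt (!a) e) : ℝ) / S.Lstar) with h | h
    · rw [min_eq_left h]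
      exact (min_le_left _ _).trans (by linarith)
    · rw [min_eq_right h]
      exact (min_le_right _ _).trans h'

theorem level_le_of_covered {e : Σ k : ℕ, (S.graph k).E} :
    ∀ {n : ℕ} {g : (S.graph n).E}, S.Covered {e} n g → e.1 ≤ n
  | 0, _, h => by rw [← Finset.mem_singleton.1 h]
  | n + 1, _, h => by
    rcases h with h | h
    · rw [← Finset.mem_singleton.1 h]
    · exact (level_le_of_covered h).trans n.le_succ

theorem Covered.exists_mem {Ω : Finset (Σ k : ℕ, (S.graph k).E)} :
    ∀ {n : ℕ} {g : (S.graph n).E}, S.Covered Ω n g → ∃ e ∈ Ω, S.Covered {e} n g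
  | 0, g, h => ⟨⟨0, g⟩, h, Finset.mem_singleton_self _⟩
  | n + 1, g, h => by
    rcases h with h | h
    · exact ⟨_, h, Or.inl (Finset.mem_singleton_self _)⟩
    · obtain ⟨e, he, h⟩ := Covered.exists_mem h
      exact ⟨e, he, Or.inr h⟩

/-- If the edges of `x`, `y` at level `n` are disjoint, then every later level carries a potential
that separates the edges of `x`, `y` by `L_*⁻⁽ⁿ⁺¹⁾` and oscillates on the descendants of any edge
by at most the weight of this edge. -/
theorem IsNonDegenerate.exists_separating_potential (hn : S.IsNonDegenerate) {x y : S.Symbol}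
    {n : ℕ} (hxy : ¬ x.MeetsAt y n) {m : ℕ} (hnm : n ≤ m) : ∃ H : (S.graph m).V → ℝ,
    (∀ a, H ((S.graph m).endpt a (x.edge m)) = 0) ∧
    (∀ a, H ((S.graph m).endpt a (y.edge m)) = S.ratio ^ (n + 1)) ∧
    (∀ g a, H ((S.graph m).endpt a g) ≤ H ((S.graph m).endpt (!a) g) + S.ratio ^ (m + 1)) ∧
    ∀ e : Σ k : ℕ, (S.graph k).E, ∃ lo hi : ℝ, hi - lo ≤ S.ratio ^ (e.1 + 1) ∧
      ∀ g a, S.Covered {e} m g → lo ≤ H ((S.graph m).endpt a g) ∧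
        H ((S.graph m).endpt a g) ≤ hi := by
  have hpos := hn.ratio_pos
  induction m, hnm using Nat.le_induction with
  | base =>
    classical
    have hH : ∀ v, 0 ≤ (if v ∈ (S.graph n).ends (x.edge n) then 0 else S.ratio ^ (n + 1)) ∧
        (if v ∈ (S.graph n).ends (x.edge n) then 0 else S.ratio ^ (n + 1)) ≤
          S.ratio ^ (n + 1) := by
      intro v
      split_ifs
      · exact ⟨le_rfl, by positivity⟩
      · exact ⟨by positivity, le_rfl⟩
    refine ⟨fun v => if v ∈ (S.graph n).ends (x.edge n) then 0 else S.ratio ^ (n + 1),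
      fun a => if_pos (LabelledGraph.mem_ends.2 ⟨a, rfl⟩), fun a => if_neg fun h => ?_,
      fun g a => ?_, fun e => ?_⟩
    · obtain ⟨b, hb⟩ := LabelledGraph.mem_ends.1 h
      exact hxy ⟨b, a, hb⟩
    · have h1 := (hH ((S.graph n).endpt a g)).2
      have h2 := (hH ((S.graph n).endpt (!a) g)).1
      linarith
    · by_cases he : e.1 ≤ n
      · refine ⟨0, S.ratio ^ (n + 1), ?_, fun g a _ => hH _⟩
        rw [sub_zero]
        exact pow_le_pow_of_le_one hpos.le hn.ratio_le_one (by omega)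
      · exact ⟨0, 0, by simpa using pow_nonneg hpos.le _,
          fun g a h => absurd (level_le_of_covered h) he⟩
  | succ m _ ih =>
    obtain ⟨H, hx, hy, hlip, hbr⟩ := ih
    obtain ⟨p, hp, hp0, hp1, hpl⟩ := hn.exists_potential
    -- The new potential interpolates the old one inside every copy of the generator.
    set F : S.gen.V × (S.graph m).E → ℝ := fun q => H ((S.graph m).endpt false q.2) +
      p q.1 * (H ((S.graph m).endpt true q.2) - H ((S.graph m).endpt false q.2)) with hF
    have hFφ : ∀ s i f, F (S.φ s i, f) = H ((S.graph m).endpt s f) := by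
      intro s i f
      cases s <;> simp [hF, hp0, hp1]
    have hFb : ∀ lo hi v q,
        (∀ a, lo ≤ H ((S.graph m).endpt a q) ∧ H ((S.graph m).endpt a q) ≤ hi) →
        lo ≤ F (v, q) ∧ F (v, q) ≤ hi := by
      intro lo hi v q h
      obtain ⟨h1, h2⟩ := h false
      obtain ⟨h3, h4⟩ := h true
      obtain ⟨h5, h6⟩ := hp v
      simp only [hF]
      constructor <;> nlinarith
    have hwd : ∀ q q', S.GlueRel (S.graph m) q q' → F q = F q' := by
      rintro _ _ ⟨s, t, e, f, i, h⟩
      rw [hFφ, hFφ, h]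
    have hFl : ∀ (g : S.gen.E) (q : (S.graph m).E) (a : Bool),
        F (S.gen.endpt a g, q) ≤ F (S.gen.endpt (!a) g, q) + S.ratio ^ (m + 1 + 1) := by
      intro g q a
      have h1 := hpl g a
      have h2 := hpl g (!a)
      rw [Bool.not_not] at h2
      have h3 := hlip q true
      have h4 := hlip q false
      simp only [Bool.not_true, Bool.not_false] at h3 h4
      have h5 : |(p (S.gen.endpt a g) - p (S.gen.endpt (!a) g)) *
          (H ((S.graph m).endpt true q) - H ((S.graph m).endpt false q))| ≤
            S.ratio * S.ratio ^ (m + 1) := by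
        rw [abs_mul]
        exact mul_le_mul (abs_le.2 ⟨by linarith, by linarith⟩)
          (abs_le.2 ⟨by linarith, by linarith⟩) (abs_nonneg _) hpos.le
      have h6 := (le_abs_self _).trans h5
      rw [← pow_succ'] at h6
      simp only [hF]
      linarith
    refine ⟨Quot.lift F hwd, fun a => ?_, fun a => ?_, fun g a => hFl g.1 g.2 a, fun e => ?_⟩
    · rw [Symbol.endpt_succ]
      have := hFb 0 0 (S.gen.endpt a (x.letter (m + 1))) (x.edge m) fun a => by simp [hx]
      exact le_antisymm this.2 this.1
    · rw [Symbol.endpt_succ]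
      have := hFb (S.ratio ^ (n + 1)) (S.ratio ^ (n + 1)) (S.gen.endpt a (y.letter (m + 1)))
        (y.edge m) fun a => by simp [hy]
      exact le_antisymm this.2 this.1
    · by_cases he : e.1 = m + 1
      · obtain ⟨k, g⟩ := e
        obtain rfl : k = m + 1 := he
        have hg := hFl g.1 g.2
        refine ⟨min (F (S.gen.endpt false g.1, g.2)) (F (S.gen.endpt true g.1, g.2)),
          max (F (S.gen.endpt false g.1, g.2)) (F (S.gen.endpt true g.1, g.2)), ?_, ?_⟩
        · have h1 := hg true
          have h2 := hg false
          simp only [Bool.not_true, Bool.not_false] at h1 h2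
          rw [max_sub_min_eq_abs, abs_le]
          constructor <;> linarith
        · rintro f a (h | h)
          · obtain rfl : f = g := by simpa using h
            cases a
            · exact ⟨min_le_left _ _, le_max_left _ _⟩
            · exact ⟨min_le_right _ _, le_max_right _ _⟩
          · exact absurd (level_le_of_covered h) (by simp)
      · obtain ⟨lo, hi, hlen, h⟩ := hbr e
        refine ⟨lo, hi, hlen, ?_⟩
        rintro f a (hf | hf)
        · exact absurd (by rw [← Finset.mem_singleton.1 hf]) he
        · exact hFb lo hi _ _ fun a => h _ a hf

open MeasureTheory in
/-- Edges that are disjoint at level `n` stay at distance at least `L_*⁻⁽ⁿ⁺¹⁾`: the values of the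
separating potential along a connection are covered by intervals whose lengths are the weights of
the edges used. -/
theorem IsNonDegenerate.le_levelDist (hn : S.IsNonDegenerate) {x y : S.Symbol}
    {n : ℕ} (hxy : ¬ x.MeetsAt y n) {m : ℕ} (hnm : n ≤ m) :
    S.ratio ^ (n + 1) ≤ x.levelDist y m := by
  obtain ⟨H, hx, hy, -, hbr⟩ := hn.exists_separating_potential hxy hnm
  choose lo hi hlen hbr using hbr
  refine le_of_forall_gt_imp_ge_of_dense fun c hc => ?_
  obtain ⟨Ω, -, hc, a, b, h⟩ := Symbol.exists_weight_lt hc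
  refine le_trans ?_ hc.le
  have hsub : Set.uIoc (H ((S.graph m).endpt a (x.edge m)))
      (H ((S.graph m).endpt b (y.edge m))) ⊆ ⋃ e ∈ Ω, Set.Icc (lo e) (hi e) := by
    refine Joined.induction (R := fun v w => Set.uIoc (H v) (H w) ⊆ ⋃ e ∈ Ω, Set.Icc (lo e) (hi e))
      (by simp) (fun g a v hg ih => ?_) h
    have hunion : ∀ r s t : ℝ, Set.uIoc r t ⊆ Set.uIoc r s ∪ Set.uIoc s t := fun r s t c => by
      simp only [Set.mem_union, Set.mem_uIoc]
      grind
    refine (hunion _ (H ((S.graph m).endpt (!a) g)) _).trans (Set.union_subset ?_ ih)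
    obtain ⟨e, he, hg⟩ := hg.exists_mem
    exact (Set.uIoc_subset_uIcc.trans (Set.uIcc_subset_Icc (hbr e g a hg) (hbr e g _ hg))).trans
      (Set.subset_biUnion_of_mem (u := fun e => Set.Icc (lo e) (hi e)) he)
  have hvol := (measure_mono (μ := volume) hsub).trans (measure_biUnion_finset_le Ω _)
  simp only [Real.volume_uIoc, Real.volume_Icc, hx, hy, sub_zero] at hvol
  have hpos := hn.ratio_pos
  rw [abs_of_nonneg (by positivity)] at hvol
  have h2 : ∑ e ∈ Ω, ENNReal.ofReal (hi e - lo e) ≤ ENNReal.ofReal (weight Ω) := by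
    rw [weight, ENNReal.ofReal_sum_of_nonneg fun e _ => by positivity]
    exact Finset.sum_le_sum fun e _ => ENNReal.ofReal_le_ofReal (hlen e)
  exact (ENNReal.ofReal_le_ofReal_iff (hn.weight_nonneg Ω)).1 (hvol.trans h2)

/-! ### The intrinsic metric -/

/-- The intrinsic distance of two symbols, the limit of `d_n(x_n, y_n)`.  It is written as the
infimum of a non-increasing perturbation of this sequence. -/
noncomputable def Symbol.limitDist (x y : S.Symbol) : ℝ :=
  ⨅ n : ℕ, (x.levelDist y n + 4 * S.ratio ^ (n + 1))

theorem IsNonDegenerate.tendsto_ratio_pow (hn : S.IsNonDegenerate) (c : ℝ) :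
    Tendsto (fun n : ℕ => c * S.ratio ^ (n + 1)) atTop (𝓝 0) := by
  have := (tendsto_pow_atTop_nhds_zero_of_lt_one hn.ratio_pos.le
    (hn.ratio_le_half.trans_lt (by norm_num))).comp (tendsto_add_atTop_nat 1)
  simpa using this.const_mul c

theorem IsNonDegenerate.tendsto_levelDist (hn : S.IsNonDegenerate) (x y : S.Symbol) :
    Tendsto (x.levelDist y) atTop (𝓝 (x.limitDist y)) := by
  have hpos := hn.ratio_pos
  have hanti : Antitone fun n : ℕ => x.levelDist y n + 4 * S.ratio ^ (n + 1) := by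
    refine antitone_nat_of_succ_le fun n => ?_
    have h1 := hn.levelDist_le_of_le x y n.le_succ
    have h2 : S.ratio ^ (n + 1 + 1) ≤ S.ratio ^ (n + 1) * (1 / 2) := by
      rw [pow_succ _ (n + 1)]
      exact mul_le_mul_of_nonneg_left hn.ratio_le_half (by positivity)
    linarith
  have h := tendsto_atTop_ciInf hanti ⟨0, by
    rintro _ ⟨n, rfl⟩
    have := hn.levelDist_nonneg x y n
    positivity⟩
  simpa [Symbol.limitDist] using h.sub (hn.tendsto_ratio_pow 4)

theorem IsNonDegenerate.limitDist_nonneg (hn : S.IsNonDegenerate) (x y : S.Symbol) :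
    0 ≤ x.limitDist y :=
  ge_of_tendsto' (hn.tendsto_levelDist x y) fun _ => hn.levelDist_nonneg _ _ _

theorem IsNonDegenerate.limitDist_comm (hn : S.IsNonDegenerate) (x y : S.Symbol) :
    x.limitDist y = y.limitDist x :=
  tendsto_nhds_unique (hn.tendsto_levelDist x y)
    ((hn.tendsto_levelDist y x).congr fun _ => hn.levelDist_comm _ _ _)

theorem IsNonDegenerate.limitDist_triangle (hn : S.IsNonDegenerate) (x y z : S.Symbol) :
    x.limitDist z ≤ x.limitDist y + y.limitDist z := by
  refine le_of_tendsto_of_tendsto' (hn.tendsto_levelDist x z) ?_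
    fun n => hn.levelDist_triangle x y z n
  simpa using ((hn.tendsto_levelDist x y).add (hn.tendsto_levelDist y z)).add
    (hn.tendsto_ratio_pow 1)

theorem IsNonDegenerate.limitDist_le_weight_genEdges (hn : S.IsNonDegenerate) (x y : S.Symbol) :
    x.limitDist y ≤ weight S.genEdges :=
  le_of_tendsto' (hn.tendsto_levelDist x y) fun n => hn.levelDist_le_weight_genEdges x y n

/-- Symbols that meet at level `n` are close. -/
theorem IsNonDegenerate.limitDist_le (hn : S.IsNonDegenerate) {x y : S.Symbol} {n : ℕ}
    (h : x.MeetsAt y n) : x.limitDist y ≤ 2 * S.ratio ^ (n + 1) := by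
  refine le_of_tendsto (hn.tendsto_levelDist x y) ((eventually_ge_atTop n).mono fun m hm => ?_)
  simpa [hn.levelDist_eq_zero h] using hn.levelDist_le_of_le x y hm

/-- Symbols that do not meet at level `n` are far apart. -/
theorem IsNonDegenerate.le_limitDist (hn : S.IsNonDegenerate) {x y : S.Symbol} {n : ℕ}
    (h : ¬ x.MeetsAt y n) : S.ratio ^ (n + 1) ≤ x.limitDist y :=
  ge_of_tendsto (hn.tendsto_levelDist x y)
    ((eventually_ge_atTop n).mono fun _ hm => hn.le_levelDist h hm)

theorem IsNonDegenerate.limitDist_eq_zero_iff (hn : S.IsNonDegenerate) {x y : S.Symbol} :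
    x.limitDist y = 0 ↔ S.SymbolRel x y := by
  rw [symbolRel_iff]
  constructor
  · intro h n
    by_contra hm
    exact absurd (hn.le_limitDist hm) (by simpa [h] using pow_pos hn.ratio_pos _)
  · intro h
    exact le_antisymm (ge_of_tendsto' (hn.tendsto_ratio_pow 2) fun n => hn.limitDist_le (h n))
      (hn.limitDist_nonneg x y)

theorem IsNonDegenerate.limitDist_congr (hn : S.IsNonDegenerate) {x x' : S.Symbol}
    (h : S.SymbolRel x x') (y : S.Symbol) : x.limitDist y = x'.limitDist y := by
  have h0 := hn.limitDist_eq_zero_iff.2 h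
  have h1 := hn.limitDist_triangle x x' y
  have h2 := hn.limitDist_triangle x' x y
  rw [hn.limitDist_comm x' x] at h2
  linarith

/-- The intrinsic metric on the limit space. -/
@[reducible]
noncomputable def IsNonDegenerate.limitMetric (hn : S.IsNonDegenerate) :
    MetricSpace S.LimitSpace where
  dist := Quot.lift (fun x => Quot.lift (fun y => x.limitDist y) fun y y' h => by
      simp only [hn.limitDist_comm x, hn.limitDist_congr h])
    fun x x' h => by
      funext y
      induction y using Quot.ind
      exact hn.limitDist_congr h _
  dist_self p := by
    induction p using Quot.ind
    exact hn.limitDist_eq_zero_iff.2 ((symbolRel_equivalence hn).refl _)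
  dist_comm p q := by
    induction p using Quot.ind
    induction q using Quot.ind
    exact hn.limitDist_comm _ _
  dist_triangle p q r := by
    induction p using Quot.ind
    induction q using Quot.ind
    induction r using Quot.ind
    exact hn.limitDist_triangle _ _ _
  eq_of_dist_eq_zero {p q} h := by
    induction p using Quot.ind
    induction q using Quot.ind
    exact Quot.sound (hn.limitDist_eq_zero_iff.1 h)

theorem IsNonDegenerate.isIntrinsicMetric (hn : S.IsNonDegenerate) :
    S.IsIntrinsicMetric hn.limitMetric :=
  fun x y => hn.tendsto_levelDist x y

/-! ### Stars of vertices -/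

/-- In a doubling system the vertex `φ_s(i)` has exactly one incident edge. -/
theorem IsDoubling.exists_edge (hd : S.IsDoubling) (s : Bool) (i : S.I) :
    ∃ g a, S.gen.endpt a g = S.φ s i := by
  obtain ⟨g, hg⟩ := Set.ncard_eq_one.1 (hd s i)
  have : g ∈ {e | S.φ s i ∈ S.gen.ends e} := by rw [hg]; rfl
  exact ⟨g, LabelledGraph.mem_ends.1 this⟩

theorem IsDoubling.edge_unique (hd : S.IsDoubling) {s : Bool} {i : S.I} {g h : S.gen.E}
    {a b : Bool} (hg : S.gen.endpt a g = S.φ s i) (hh : S.gen.endpt b h = S.φ s i) : g = h := by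
  obtain ⟨f, hf⟩ := Set.ncard_eq_one.1 (hd s i)
  have h1 : g ∈ {e | S.φ s i ∈ S.gen.ends e} := LabelledGraph.mem_ends.2 ⟨a, hg⟩
  have h2 : h ∈ {e | S.φ s i ∈ S.gen.ends e} := LabelledGraph.mem_ends.2 ⟨b, hh⟩
  rw [hf] at h1 h2
  exact h1.trans h2.symm

/-- A bijection between the edges incident to a vertex `v` of level `n` and the edges of the
generator incident to a vertex `v'`.  The sign `sgn e` records whether the label of the endpoint `v`
of `e` and the label of the endpoint `v'` of `edge e` are different.  The values of `edge` and `sgn`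
on edges that are not incident to `v` are irrelevant. -/
structure StarIso (S : SimpleIGS.{u, w}) (n : ℕ) (v : (S.graph n).V) (v' : S.gen.V) where
  edge : (S.graph n).E → S.gen.E
  sgn : (S.graph n).E → Bool
  endpt_edge : ∀ e a, (S.graph n).endpt a e = v → S.gen.endpt (a ^^ sgn e) (edge e) = v'
  surj : ∀ h b, S.gen.endpt b h = v' → ∃ e a, (S.graph n).endpt a e = v ∧ edge e = h
  inj : ∀ e f a b, (S.graph n).endpt a e = v → (S.graph n).endpt b f = v → edge e = edge f → e = f

/-- Every star of a replacement graph is isomorphic to a star of the generator: a vertex `[w, e]`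
with `w ∉ I₋ ∪ I₊` has the star of `w`, and the star of `[φ_s(i), e]` is, by doubling, that of the
endpoint `e^s` at the previous level. -/
theorem exists_starIso (hd : S.IsDoubling) (hn : S.IsNonDegenerate) :
    ∀ (n : ℕ) (v : (S.graph n).V), ∃ v', Nonempty (StarIso S n v v')
  | 0, v => ⟨v, ⟨{
      edge := fun e => e
      sgn := fun _ => false
      endpt_edge := fun e a h => by rw [Bool.xor_false]; exact h
      surj := fun h b hb => ⟨h, b, hb, rfl⟩
      inj := fun _ _ _ _ _ _ h => h }⟩⟩
  | n + 1, v => by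
    obtain ⟨w, e₀⟩ := v
    by_cases hw : ∃ s i, w = S.φ s i
    · obtain ⟨s, i, rfl⟩ := hw
      obtain ⟨v', ⟨Θ⟩⟩ := exists_starIso hd hn n ((S.graph n).endpt s e₀)
      have key : ∀ (g : S.gen.E) (f : (S.graph n).E) (a : Bool),
          (S.graph (n + 1)).endpt a (g, f) = Quot.mk _ (S.φ s i, e₀) ↔
          ∃ t, S.gen.endpt a g = S.φ t i ∧ (S.graph n).endpt t f = (S.graph n).endpt s e₀ := by
        intro g f a
        refine (replace_mk_eq_iff (S.graph n)).trans ⟨?_, ?_⟩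
        · rintro (⟨h1, h2⟩ | ⟨t, s', j, h1, h2, h3⟩)
          · exact ⟨s, h1, congrArg ((S.graph n).endpt s) h2⟩
          · obtain ⟨rfl, rfl⟩ := φ_eq_iff.1 h2
            exact ⟨t, h1, h3⟩
        · rintro ⟨t, h1, h2⟩
          exact Or.inr ⟨t, s, i, h1, rfl, h2⟩
      -- `κ g` compares the label of the endpoint `φ_t(i)` of `g` with `t`.
      have hκ : ∀ g : S.gen.E, ∃ κ : Bool, ∀ a t, S.gen.endpt a g = S.φ t i → κ = (a ^^ t) := by
        intro g
        by_cases h : ∃ a t, S.gen.endpt a g = S.φ t i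
        · obtain ⟨a, t, h⟩ := h
          refine ⟨a ^^ t, fun b t' h' => ?_⟩
          obtain ⟨rfl, rfl, -⟩ := hn.endpt_unique h h'
          rfl
        · exact ⟨false, fun a t h' => absurd ⟨a, t, h'⟩ h⟩
      choose κ hκ using hκ
      refine ⟨v', ⟨{
        edge := fun p => Θ.edge p.2
        sgn := fun p => κ p.1 ^^ Θ.sgn p.2
        endpt_edge := ?_
        surj := ?_
        inj := ?_ }⟩⟩
      · rintro ⟨g, f⟩ a h
        obtain ⟨t, h1, h2⟩ := (key g f a).1 h
        have hsgn : (a ^^ (κ g ^^ Θ.sgn f)) = (t ^^ Θ.sgn f) := by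
          rw [hκ g a t h1]
          cases a <;> cases t <;> simp
        exact (congrArg (fun c => S.gen.endpt c (Θ.edge f)) hsgn).trans (Θ.endpt_edge f t h2)
      · intro h b hb
        obtain ⟨f, t, h1, h2⟩ := Θ.surj h b hb
        obtain ⟨g, a, hg⟩ := hd.exists_edge t i
        exact ⟨(g, f), a, (key g f a).2 ⟨t, hg, h1⟩, h2⟩
      · rintro ⟨g, f⟩ ⟨g', f'⟩ a b h h' heq
        obtain ⟨t, h1, h2⟩ := (key g f a).1 h
        obtain ⟨t', h1', h2'⟩ := (key g' f' b).1 h'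
        obtain rfl := Θ.inj f f' t t' h2 h2' heq
        obtain rfl := endpt_inj (h2.trans h2'.symm)
        rw [hd.edge_unique h1 h1']
    · have key : ∀ (g : S.gen.E) (f : (S.graph n).E) (a : Bool),
          (S.graph (n + 1)).endpt a (g, f) = Quot.mk _ (w, e₀) ↔
            S.gen.endpt a g = w ∧ f = e₀ := by
        intro g f a
        refine (replace_mk_eq_iff (S.graph n)).trans (or_iff_left ?_)
        rintro ⟨_, t, i, -, h, -⟩
        exact hw ⟨t, i, h⟩
      refine ⟨w, ⟨{
        edge := fun p => p.1
        sgn := fun _ => false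
        endpt_edge := ?_
        surj := ?_
        inj := ?_ }⟩⟩
      · rintro ⟨g, f⟩ a h
        rw [Bool.xor_false]
        exact ((key g f a).1 h).1
      · intro h b hb
        exact ⟨(h, e₀), b, (key h e₀ b).2 ⟨hb, rfl⟩, rfl⟩
      · rintro ⟨g, f⟩ ⟨g', f'⟩ a b h h' heq
        exact Prod.ext heq (((key g f a).1 h).2.trans ((key g' f' b).1 h').2.symm)

/-! ### Twisting words by the symmetry -/

/-- The identity (for the sign `false`) and the symmetry `η` (for the sign `true`) of the generator,
with the information whether they preserve or exchange the labels of the endpoints of an edge. -/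
structure Twist (S : SimpleIGS.{u, w}) where
  act : Bool → S.gen.V ≃ S.gen.V
  turn : Bool → S.gen.E ≃ S.gen.E
  sgn : Bool → S.gen.E → Bool
  endpt_turn : ∀ σ g a, S.gen.endpt (a ^^ sgn σ g) (turn σ g) = act σ (S.gen.endpt a g)
  act_φ : ∀ σ s i, act σ (S.φ s i) = S.φ (s ^^ σ) i

theorem IsSymmetric.nonempty_twist (hs : S.IsSymmetric) : Nonempty (Twist S) := by
  obtain ⟨η, ηE, hE, hφ⟩ := hs
  have hτ : ∀ g, ∃ τ : Bool, ∀ a, S.gen.endpt (a ^^ τ) (ηE g) = η (S.gen.endpt a g) := by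
    intro g
    have h : S.gen.ends (ηE g) =
        s(η (S.gen.endpt false g), η (S.gen.endpt true g)) := by rw [hE]; rfl
    obtain ⟨τ, h1, h2⟩ := LabelledGraph.ends_eq_mk_iff.1 h
    exact ⟨τ, fun a => by cases a <;> simp [h1, h2]⟩
  choose τ hτ using hτ
  exact ⟨{
    act := fun σ => if σ then η else Equiv.refl _
    turn := fun σ => if σ then ηE else Equiv.refl _
    sgn := fun σ g => σ && τ g
    endpt_turn := fun σ g a => by cases σ <;> simp [hτ]
    act_φ := fun σ s i => by cases σ <;> simp [hφ] }⟩

namespace Twist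

variable (T : Twist S) (σ : Bool) (g : ℕ → S.gen.E)

/-- The orientation of the twisted edge after `m` letters of the word `g`. -/
def state : ℕ → Bool
  | 0 => σ
  | m + 1 => T.sgn (state m) (g m)

/-- The word `g` read through the symmetry: a copy of the generator that sits in an edge with
reversed labels has to be reversed by `η`. -/
def word (m : ℕ) : S.gen.E := T.turn (T.state σ g m) (g m)

theorem endpt_turn_eq_φ_iff {σ : Bool} {g : S.gen.E} {a s : Bool} {i : S.I} :
    S.gen.endpt (a ^^ T.sgn σ g) (T.turn σ g) = S.φ (s ^^ σ) i ↔ S.gen.endpt a g = S.φ s i := by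
  rw [T.endpt_turn, ← T.act_φ, (T.act σ).apply_eq_iff_eq]

variable {g} in
theorem word_agree_iff {h : ℕ → S.gen.E} (m : ℕ) :
    ((∀ k < m, g k = h k) ↔ ∀ k < m, T.word σ g k = T.word σ h k) ∧
      ((∀ k < m, g k = h k) → T.state σ g m = T.state σ h m) := by
  induction m with
  | zero => simp [state]
  | succ m ih =>
    obtain ⟨ih1, ih2⟩ := ih
    simp only [Nat.lt_succ_iff_lt_or_eq, or_imp, forall_and, forall_eq]
    refine ⟨?_, fun ⟨h1, h2⟩ => by simp only [state, ih2 h1, h2]⟩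
    rw [← ih1]
    refine and_congr_right fun h1 => ?_
    rw [word, word, ih2 h1, (T.turn _).apply_eq_iff_eq]

/-- Every word is the twist of a word. -/
theorem exists_word_eq : ∃ h, T.word σ h = g := by
  let P : ℕ → Bool := fun m => Nat.rec σ (fun m p => T.sgn p ((T.turn p).symm (g m))) m
  refine ⟨fun m => (T.turn (P m)).symm (g m), ?_⟩
  have hP : ∀ m, T.state σ (fun m => (T.turn (P m)).symm (g m)) m = P m := by
    intro m
    induction m with
    | zero => rfl
    | succ m ih => rw [state, ih]
  funext m
  rw [word, hP, Equiv.apply_symm_apply]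

end Twist

/-! ### Coincidences along words -/

/-- The recursion that decides which endpoints coincide after `m` replacements along the words `g`,
`h`, if initially the coincidences are given by `R`, and `E` says whether the two initial edges are
equal. -/
def Coincide (E : Prop) (R : Bool → Bool → Prop) (g h : ℕ → S.gen.E) : ℕ → Bool → Bool → Prop
  | 0, a, b => R a b
  | m + 1, a, b => (E ∧ (∀ k < m, g k = h k) ∧ S.gen.endpt a (g m) = S.gen.endpt b (h m)) ∨
      ∃ s t i, Coincide E R g h m s t ∧ S.gen.endpt a (g m) = S.φ s i ∧ S.gen.endpt b (h m) = S.φ t i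

theorem Coincide.mono {E : Prop} {R R' : Bool → Bool → Prop} {g h : ℕ → S.gen.E}
    (hR : ∀ a b, R a b → R' a b) : ∀ {m : ℕ} {a b : Bool},
      Coincide E R g h m a b → Coincide E R' g h m a b
  | 0, _, _, hc => hR _ _ hc
  | _ + 1, _, _, hc => hc.imp_right fun ⟨s, t, i, h1, h2, h3⟩ => ⟨s, t, i, h1.mono hR, h2, h3⟩

theorem exists_bool_xor (ρ : Bool) (P : Bool → Prop) : (∃ s, P s) ↔ ∃ s, P (s ^^ ρ) := by
  cases ρ <;> simp [Bool.exists_bool, or_comm]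

/-- Twisting both words does not change their coincidences. -/
theorem Coincide.twist_iff (T : Twist S) {E E' : Prop} {R R' : Bool → Bool → Prop}
    {g h : ℕ → S.gen.E} {σ τ : Bool} (hE : E ↔ E') (hστ : E → σ = τ)
    (hR : ∀ a b, R a b ↔ R' (a ^^ σ) (b ^^ τ)) (m : ℕ) (a b : Bool) :
    Coincide E R g h m a b ↔
      Coincide E' R' (T.word σ g) (T.word τ h) m (a ^^ T.state σ g m) (b ^^ T.state τ h m) := by
  induction m generalizing a b with
  | zero => exact hR a b
  | succ m ih =>
    refine or_congr ?_ ?_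
    · rw [← hE]
      refine and_congr_right fun he => ?_
      obtain rfl := hστ he
      obtain ⟨h1, h2⟩ := T.word_agree_iff σ (g := g) (h := h) m
      rw [← h1]
      refine and_congr_right fun hgh => ?_
      rw [Twist.word, Twist.word, Twist.state, Twist.state, T.endpt_turn, T.endpt_turn, h2 hgh,
        (T.act _).apply_eq_iff_eq]
    · rw [exists_bool_xor (T.state σ g m) (fun s => ∃ t i, Coincide E' R' _ _ m s t ∧ _ ∧ _)]
      refine exists_congr fun s => ?_
      rw [exists_bool_xor (T.state τ h m) (fun t => ∃ i, Coincide E' R' _ _ m _ t ∧ _ ∧ _)]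
      refine exists_congr fun t => exists_congr fun i => ?_
      rw [ih]
      refine and_congr_right fun _ => and_congr ?_ ?_
      · exact T.endpt_turn_eq_φ_iff.symm
      · exact T.endpt_turn_eq_φ_iff.symm

/-- The letters of a symbol after level `n`. -/
def Symbol.tail (x : S.Symbol) (n k : ℕ) : S.gen.E := x.letter (n + k + 1)

theorem Symbol.edge_add_eq_iff (x y : S.Symbol) (n m : ℕ) : x.edge (n + m) = y.edge (n + m) ↔
    x.edge n = y.edge n ∧ ∀ k < m, x.tail n k = y.tail n k := by
  induction m with
  | zero => simp
  | succ m ih =>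
    simp only [Nat.lt_succ_iff_lt_or_eq, or_imp, forall_and, forall_eq]
    rw [← and_assoc, ← ih]
    exact (Symbol.edge_succ_eq_iff x y (n + m)).trans and_comm

theorem Symbol.endpt_eq_iff_coincide (x y : S.Symbol) (n m : ℕ) (a b : Bool) :
    (S.graph (n + m)).endpt a (x.edge (n + m)) = (S.graph (n + m)).endpt b (y.edge (n + m)) ↔
      Coincide (x.edge n = y.edge n)
        (fun a b => (S.graph n).endpt a (x.edge n) = (S.graph n).endpt b (y.edge n))
        (x.tail n) (y.tail n) m a b := by
  induction m generalizing a b with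
  | zero => rfl
  | succ m ih =>
    refine (Symbol.endpt_succ_eq_iff x y (n + m) a b).trans (or_congr ?_ ?_)
    · rw [Symbol.edge_add_eq_iff, and_assoc]; rfl
    · simp only [ih]; rfl

/-- A symbol with a prescribed edge of level `n` and prescribed letters after it. -/
theorem Symbol.exists_edge_tail (n : ℕ) (e : (S.graph n).E) (g : ℕ → S.gen.E) :
    ∃ x : S.Symbol, x.edge n = e ∧ x.tail n = g := by
  induction n generalizing g with
  | zero =>
    refine ⟨⟨fun k => Nat.rec (motive := fun k => (S.graph k).E) e
      (fun k p => ((g k, p) : S.gen.E × (S.graph k).E)) k, fun _ => rfl⟩, rfl, ?_⟩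
    funext k
    unfold Symbol.tail
    rw [Nat.zero_add]
    rfl
  | succ n ih =>
    obtain ⟨h, p⟩ := e
    obtain ⟨x, hx, ht⟩ := ih p fun k => Nat.casesOn k h g
    refine ⟨x, ?_, ?_⟩
    · have h0 : x.letter (n + 1) = h := congrFun ht 0
      rw [Symbol.edge_succ, h0, hx]
    · funext k
      have := congrFun ht (k + 1)
      unfold Symbol.tail at this ⊢
      rw [show n + 1 + k + 1 = n + (k + 1) + 1 by omega, this]

/-! ### Points near the centre of a star -/

/-- The symbols `x` and `y`, whose level-`n` edges contain the vertex `v`, touch at level `n + m`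
when coincidences at the other ends of these edges are ignored. -/
def Symbol.StarMeetsAt (n : ℕ) (v : (S.graph n).V) (x y : S.Symbol) (m : ℕ) : Prop :=
  ∃ a b, Coincide (x.edge n = y.edge n)
    (fun a b => (x.edge n = y.edge n ∧ a = b) ∨
      ((S.graph n).endpt a (x.edge n) = v ∧ (S.graph n).endpt b (y.edge n) = v))
    (x.tail n) (y.tail n) m a b

/-- The level-`n` edge of `x` contains `v`, and the edge of level `n + 2` does not reach its other
end. -/
def Symbol.NearCentre (n : ℕ) (v : (S.graph n).V) (x : S.Symbol) : Prop :=
  (∃ c, (S.graph n).endpt c (x.edge n) = v) ∧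
    ∀ a s t i j, S.gen.endpt a (x.tail n 1) = S.φ s i → S.gen.endpt s (x.tail n 0) = S.φ t j →
      (S.graph n).endpt t (x.edge n) = v

theorem Symbol.StarMeetsAt.meetsAt {n : ℕ} {v : (S.graph n).V} {x y : S.Symbol} {m : ℕ}
    (h : Symbol.StarMeetsAt n v x y m) : x.MeetsAt y (n + m) := by
  obtain ⟨a, b, h⟩ := h
  refine ⟨a, b, (Symbol.endpt_eq_iff_coincide x y n m a b).2 (h.mono fun a b => ?_)⟩
  rintro (⟨h, rfl⟩ | ⟨h, h'⟩)
  · rw [h]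
  · rw [h, h']

/-- Two levels below the star, a symbol near the centre only touches others through the centre. -/
theorem Symbol.NearCentre.starMeetsAt {n : ℕ} {v : (S.graph n).V} {x y : S.Symbol}
    (hx : x.NearCentre n v) {m : ℕ} (h : x.MeetsAt y (n + (m + 2))) :
    Symbol.StarMeetsAt n v x y (m + 2) := by
  obtain ⟨a, b, h⟩ := h
  rw [Symbol.endpt_eq_iff_coincide] at h
  refine ⟨a, b, ?_⟩
  by_cases hxy : x.edge n = y.edge n
  · refine h.mono fun a b h => Or.inl ⟨hxy, ?_⟩
    rw [← hxy] at h
    exact endpt_inj h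
  · induction m generalizing a b with
    | zero =>
      rcases h with h | ⟨s, t, i, h, hs, ht⟩
      · exact absurd h.1 hxy
      rcases h with h | ⟨s', t', j, h, hs', ht'⟩
      · exact absurd h.1 hxy
      have hv := hx.2 a s s' i j hs hs'
      exact Or.inr ⟨s, t, i, Or.inr ⟨s', t', j, Or.inr ⟨hv, Eq.trans (Eq.symm h) hv⟩, hs', ht'⟩,
        hs, ht⟩
    | succ m ih =>
      rcases h with h | ⟨s, t, i, h, hs, ht⟩
      · exact absurd h.1 hxy
      exact Or.inr ⟨s, t, i, ih s t h, hs, ht⟩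

/-- Symbols that touch a symbol near the centre pass through the star. -/
theorem Symbol.NearCentre.endpt_eq_of_meetsAt {n : ℕ} {v : (S.graph n).V} {x y : S.Symbol}
    (hx : x.NearCentre n v) (h : x.MeetsAt y (n + 2)) :
    ∃ c, (S.graph n).endpt c (y.edge n) = v := by
  by_cases hxy : x.edge n = y.edge n
  · exact hxy ▸ hx.1
  obtain ⟨a, b, h⟩ := hx.starMeetsAt (m := 0) h
  rcases h with h | ⟨s, t, i, h, -, -⟩
  · exact absurd h.1 hxy
  rcases h with h | ⟨s', t', j, h, -, -⟩
  · exact absurd h.1 hxy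
  rcases h with h | ⟨-, h⟩
  · exact absurd h.1 hxy
  · exact ⟨_, h⟩

/-- All symbols that touch `x` at level `n + 2` are near the centre of one star of level `n`. -/
theorem IsNonDegenerate.exists_nearCentre (hn : S.IsNonDegenerate) (x : S.Symbol) (n : ℕ) :
    ∃ v, ∀ y : S.Symbol, x.MeetsAt y (n + 2) → y.NearCentre n v := by
  -- The edge of level `n + 1` reaches at most one end of the edge of level `n`: this end is `v`.
  obtain ⟨s, hs⟩ : ∃ s : Bool, ∀ a t i, S.gen.endpt a (x.tail n 0) = S.φ t i → t = s := by
    by_cases h : ∃ a t i, S.gen.endpt a (x.tail n 0) = S.φ t i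
    · obtain ⟨a, t, i, h⟩ := h
      exact ⟨t, fun b t' i' h' => (hn.endpt_unique h h').2.1.symm⟩
    · exact ⟨true, fun a t i h' => absurd ⟨a, t, i, h'⟩ h⟩
  refine ⟨(S.graph n).endpt s (x.edge n), fun y ⟨a, b, hxy⟩ => ?_⟩
  rw [Symbol.endpt_eq_iff_coincide] at hxy
  by_cases h0 : x.edge n = y.edge n
  · refine ⟨⟨s, by rw [h0]⟩, fun a' p t i j h1 h2 => ?_⟩
    by_cases ht : t = s
    · rw [h0, ht]
    exfalso
    -- Otherwise the edge of `y` of level `n + 1` has an endpoint at the other end, so it differs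
    -- from that of `x`, and the edges of level `n + 2` touch over a common endpoint of the edges of
    -- level `n + 1`. As the edge of `y` of level `n + 2` lies over only one such endpoint, the one
    -- at the other end, the edge of `x` of level `n + 1` reaches this end too.
    rcases hxy with ⟨-, h, -⟩ | ⟨q, r, l, h, -, h3⟩
    · exact ht (hs p t j ((h 0 one_pos).symm ▸ h2))
    · obtain ⟨-, rfl, -⟩ := hn.endpt_unique h1 h3
      rcases h with ⟨-, -, h⟩ | ⟨t', u, k, h, h4, h5⟩
      · exact ht (hs q t j (h.trans h2))
      · obtain ⟨-, rfl, -⟩ := hn.endpt_unique h5 h2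
        rw [← h0] at h
        obtain rfl := endpt_inj h
        exact ht (hs _ _ _ h4)
  · rcases hxy with h | ⟨q, r, l, h, -, -⟩
    · exact absurd h.1 h0
    rcases h with h | ⟨t, u, k, h, h4, h5⟩
    · exact absurd h.1 h0
    obtain rfl := hs _ _ _ h4
    refine ⟨⟨u, h.symm⟩, fun a' p t' i j _ h2 => ?_⟩
    obtain ⟨-, rfl, -⟩ := hn.endpt_unique h5 h2
    exact h.symm

/-! ### The map between stars -/

namespace StarIso

variable {n : ℕ} {v : (S.graph n).V} {v' : S.gen.V} (Θ : StarIso S n v v') (T : Twist S)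

/-- The symbol whose first letter is the image of the level-`n` edge of `x` under a star
isomorphism, followed by the letters of `x` after level `n`, twisted according to orientation. -/
noncomputable def map (x : S.Symbol) : S.Symbol :=
  (Symbol.exists_edge_tail 0 (Θ.edge (x.edge n))
    (T.word (Θ.sgn (x.edge n)) (x.tail n))).choose

theorem map_edge (x : S.Symbol) : (Θ.map T x).edge 0 = Θ.edge (x.edge n) :=
  (Symbol.exists_edge_tail 0 (Θ.edge (x.edge n)) _).choose_spec.1

theorem map_tail (x : S.Symbol) :
    (Θ.map T x).tail 0 = T.word (Θ.sgn (x.edge n)) (x.tail n) :=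
  (Symbol.exists_edge_tail 0 (Θ.edge (x.edge n)) _).choose_spec.2

variable {Θ T}

theorem map_endpt_eq_iff {x : S.Symbol} (hx : ∃ c, (S.graph n).endpt c (x.edge n) = v)
    (a : Bool) : (S.graph 0).endpt (a ^^ Θ.sgn (x.edge n)) ((Θ.map T x).edge 0) = v' ↔
      (S.graph n).endpt a (x.edge n) = v := by
  rw [map_edge]
  refine ⟨fun h => ?_, Θ.endpt_edge _ _⟩
  obtain ⟨c, hc⟩ := hx
  have := gen_endpt_inj ((Θ.endpt_edge _ _ hc).trans h.symm)
  rw [← (Bool.xor_left_inj).1 this, hc]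

theorem starMeetsAt_map_iff {x y : S.Symbol} (hx : ∃ c, (S.graph n).endpt c (x.edge n) = v)
    (hy : ∃ c, (S.graph n).endpt c (y.edge n) = v) (m : ℕ) :
    Symbol.StarMeetsAt 0 v' (Θ.map T x) (Θ.map T y) m ↔ Symbol.StarMeetsAt n v x y m := by
  have hE : x.edge n = y.edge n ↔ (Θ.map T x).edge 0 = (Θ.map T y).edge 0 := by
    rw [map_edge, map_edge]
    obtain ⟨c, hc⟩ := hx
    obtain ⟨d, hd⟩ := hy
    exact ⟨fun h => by rw [h], Θ.inj _ _ c d hc hd⟩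
  unfold Symbol.StarMeetsAt
  rw [exists_bool_xor (T.state (Θ.sgn (x.edge n)) (x.tail n) m)]
  refine exists_congr fun a => ?_
  rw [exists_bool_xor (T.state (Θ.sgn (y.edge n)) (y.tail n) m)]
  refine exists_congr fun b => ?_
  rw [map_tail, map_tail]
  refine (Coincide.twist_iff T hE (fun h => by rw [h]) (fun a b => or_congr ?_ ?_) m a b).symm
  · rw [hE]
    refine and_congr_right fun h => ?_
    rw [← hE] at h
    rw [h, Bool.xor_left_inj]
  · rw [map_endpt_eq_iff hx, map_endpt_eq_iff hy]

theorem nearCentre_map {x : S.Symbol} (hx : x.NearCentre n v) :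
    (Θ.map T x).NearCentre 0 v' := by
  obtain ⟨⟨c, hc⟩, h⟩ := hx
  refine ⟨⟨_, (map_endpt_eq_iff ⟨c, hc⟩ c).2 hc⟩, fun a s t i j h1 h2 => ?_⟩
  rw [map_tail] at h1 h2
  set σ := Θ.sgn (x.edge n) with hσ
  have hinv : ∀ a ρ : Bool, a = ((a ^^ ρ) ^^ ρ) := fun a ρ => by cases a <;> cases ρ <;> rfl
  rw [Twist.word, hinv s (T.state σ (x.tail n) 1), hinv a (T.sgn _ _), T.endpt_turn_eq_φ_iff] at h1
  rw [Twist.word, hinv t (T.state σ (x.tail n) 0), hinv s (T.sgn _ _), T.endpt_turn_eq_φ_iff] at h2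
  rw [hinv t σ, map_endpt_eq_iff ⟨c, hc⟩]
  exact h _ _ _ _ _ h1 h2

/-- Every symbol through the target star is in the image. -/
theorem exists_map_eq {z : S.Symbol} (hz : ∃ c, (S.graph 0).endpt c (z.edge 0) = v') :
    ∃ x : S.Symbol, (∃ c, (S.graph n).endpt c (x.edge n) = v) ∧ Θ.map T x = z := by
  obtain ⟨c, hc⟩ := hz
  obtain ⟨e, a, he, heq⟩ := Θ.surj _ c hc
  obtain ⟨g, hg⟩ := T.exists_word_eq (Θ.sgn e) (z.tail 0)
  obtain ⟨x, rfl, rfl⟩ := Symbol.exists_edge_tail n e g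
  refine ⟨x, ⟨a, he⟩, Subtype.ext (funext fun k => ?_)⟩
  have := (Symbol.edge_add_eq_iff (Θ.map T x) z 0 k).2
    ⟨by rw [map_edge, heq], fun k _ => by rw [map_tail, hg]⟩
  rwa [Nat.zero_add] at this

/-- Near the centres of the stars, the map preserves the relation of touching, with a shift of
levels. -/
theorem meetsAt_map_iff {x y : S.Symbol} (hx : x.NearCentre n v)
    (hy : ∃ c, (S.graph n).endpt c (y.edge n) = v) (m : ℕ) :
    (Θ.map T x).MeetsAt (Θ.map T y) (m + 2) ↔ x.MeetsAt y (n + (m + 2)) := by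
  have h0 : ∀ k, (Θ.map T x).MeetsAt (Θ.map T y) k ↔
      (Θ.map T x).MeetsAt (Θ.map T y) (0 + k) := fun k => by rw [Nat.zero_add]
  rw [h0]
  constructor
  · intro h
    exact ((starMeetsAt_map_iff hx.1 hy _).1 ((nearCentre_map hx).starMeetsAt h)).meetsAt
  · intro h
    exact ((starMeetsAt_map_iff hx.1 hy _).2 (hx.starMeetsAt h)).meetsAt

end StarIso

/-! ### Approximate self-similarity -/

/-- The point of the limit space with symbol `x`. -/
def Symbol.point (x : S.Symbol) : S.LimitSpace := Quot.mk S.SymbolRel x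

theorem Symbol.exists_point_eq (p : S.LimitSpace) : ∃ x : S.Symbol, x.point = p :=
  Quot.exists_rep p

theorem IsNonDegenerate.point_eq_iff (hn : S.IsNonDegenerate) {x y : S.Symbol} :
    x.point = y.point ↔ S.SymbolRel x y :=
  (symbolRel_equivalence hn).quot_mk_eq_iff x y

/-- Since the distance of two symbols is comparable to the weight of the last level at which they
meet, a control of the levels of meeting is a Lipschitz estimate. -/
theorem IsNonDegenerate.limitDist_le_of_meetsAt (hn : S.IsNonDegenerate) {x y x' y' : S.Symbol}
    {n n' : ℕ} (h0 : x'.MeetsAt y' n')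
    (h : ∀ m, x.MeetsAt y (n + (m + 2)) → x'.MeetsAt y' (n' + (m + 2))) :
    x'.limitDist y' * S.ratio ^ (n + 2) ≤ 2 * S.ratio ^ n' * x.limitDist y := by
  have hpos := hn.ratio_pos
  by_cases hall : ∀ m, x.MeetsAt y (n + (m + 2))
  · have : S.SymbolRel x' y' := symbolRel_iff.2 fun m => (h m (hall m)).mono (by omega)
    rw [hn.limitDist_eq_zero_iff.2 this, zero_mul]
    have := hn.limitDist_nonneg x y
    positivity
  push Not at hall
  classical
  have hN := Nat.find_spec hall
  have hmin : ∀ m < Nat.find hall, x.MeetsAt y (n + (m + 2)) := fun m hm =>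
    not_not.1 (Nat.find_min hall hm)
  generalize Nat.find hall = N at hN hmin
  have h1 : x'.limitDist y' ≤ 2 * S.ratio ^ (n' + N + 1) := by
    cases N with
    | zero => exact hn.limitDist_le h0
    | succ N =>
      exact hn.limitDist_le ((h N (hmin N N.lt_succ_self)).mono (by omega))
  calc x'.limitDist y' * S.ratio ^ (n + 2)
      ≤ 2 * S.ratio ^ (n' + N + 1) * S.ratio ^ (n + 2) := by gcongr
    _ = 2 * S.ratio ^ n' * S.ratio ^ (n + (N + 2) + 1) := by ring
    _ ≤ 2 * S.ratio ^ n' * x.limitDist y := by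
      gcongr
      exact hn.le_limitDist hN

theorem IsNonDegenerate.meetsAt_of_limitDist_lt (hn : S.IsNonDegenerate) {x y : S.Symbol} {n : ℕ}
    (h : x.limitDist y < S.ratio ^ (n + 1)) : x.MeetsAt y n := by
  by_contra hm
  exact absurd (hn.le_limitDist hm) h.not_ge

namespace StarIso

variable {n : ℕ} {v : (S.graph n).V} {v' : S.gen.V} {Θ : StarIso S n v v'} {T : Twist S}

/-- Near the centre of the star, the map expands distances by at most a constant times
`L_*ⁿ`. -/
theorem limitDist_map_le (hn : S.IsNonDegenerate) {x y : S.Symbol}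
    (hx : x.NearCentre n v) (hy : y.NearCentre n v) :
    (Θ.map T x).limitDist (Θ.map T y) * S.ratio ^ (n + 2) ≤ 2 * x.limitDist y := by
  obtain ⟨c, hc⟩ := hx.1
  obtain ⟨d, hd⟩ := hy.1
  have := hn.limitDist_le_of_meetsAt (x := x) (y := y) (x' := Θ.map T x) (y' := Θ.map T y)
    (n := n) (n' := 0)
    ⟨_, _, ((map_endpt_eq_iff hx.1 c).2 hc).trans ((map_endpt_eq_iff hy.1 d).2 hd).symm⟩
    (fun m h => by
      rw [Nat.zero_add]
      exact (meetsAt_map_iff hx hy.1 m).2 h)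
  simpa using this

/-- Near the centre of the star, the map expands distances by at least a constant times
`L_*ⁿ`. -/
theorem le_limitDist_map (hn : S.IsNonDegenerate) {x y : S.Symbol}
    (hx : x.NearCentre n v) (hy : y.NearCentre n v) :
    x.limitDist y * S.ratio ^ 2 ≤
      2 * S.ratio ^ n * (Θ.map T x).limitDist (Θ.map T y) := by
  obtain ⟨c, hc⟩ := hx.1
  obtain ⟨d, hd⟩ := hy.1
  have := hn.limitDist_le_of_meetsAt (x := Θ.map T x) (y := Θ.map T y) (x' := x) (y' := y)
    (n := 0) (n' := n) ⟨c, d, hc.trans hd.symm⟩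
    (fun m h => by
      rw [Nat.zero_add] at h
      exact (meetsAt_map_iff hx hy.1 m).1 h)
  simpa using this

theorem map_rel (hn : S.IsNonDegenerate) {x y : S.Symbol} (hx : x.NearCentre n v)
    (hy : y.NearCentre n v) (h : S.SymbolRel x y) : S.SymbolRel (Θ.map T x) (Θ.map T y) := by
  rw [← hn.limitDist_eq_zero_iff] at h ⊢
  have h1 := limitDist_map_le (Θ := Θ) (T := T) hn hx hy
  rw [h, mul_zero] at h1
  exact le_antisymm (nonpos_of_mul_nonpos_left h1 (pow_pos hn.ratio_pos _))
    (hn.limitDist_nonneg _ _)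

end StarIso

theorem IsNonDegenerate.approximatelySelfSimilar (hn : S.IsNonDegenerate) (hd : S.IsDoubling)
    (hs : S.IsSymmetric) : @ApproximatelySelfSimilar S.LimitSpace hn.limitMetric := by
  let _ := hn.limitMetric
  have hdist : ∀ x y : S.Symbol,
      dist x.point y.point = x.limitDist y :=
    fun _ _ => rfl
  have hpos := hn.ratio_pos
  have hle1 := hn.ratio_le_one
  have hD := hn.weight_nonneg S.genEdges
  set D := weight S.genEdges with hD'
  obtain ⟨T⟩ := hs.nonempty_twist
  have hinv : (1 : ℝ) ≤ (S.ratio ^ 6)⁻¹ := (one_le_inv₀ (by positivity)).2 (pow_le_one₀ hpos.le hle1)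
  set L : ℝ := 2 * (S.ratio ^ 6)⁻¹ + D with hL
  have hL1 : 1 < L := by linarith
  have hL6 : 2 ≤ L * S.ratio ^ 6 := by
    rw [hL, add_mul, mul_assoc, inv_mul_cancel₀ (by positivity)]
    have : 0 ≤ D * S.ratio ^ 6 := by positivity
    linarith
  refine ⟨L, hL1, fun p r hr hrdiam => ?_⟩
  have hrescale : ∀ a b : ℝ, a ≤ L * r * b → b * r ≤ L * a →
      L⁻¹ * (a / r) ≤ b ∧ b ≤ L * (a / r) := by
    intro a b h1 h2
    constructor
    · rw [inv_mul_le_iff₀ (by linarith), div_le_iff₀ hr]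
      linarith
    · rw [← mul_div_assoc, le_div_iff₀ hr]
      exact h2
  rcases lt_or_ge (S.ratio ^ 3) r with hbig | hsmall
  · -- The radius is bounded above and below by constants, so the inclusion of the ball will do.
    have hrD : r ≤ D := by
      have h1 : Metric.ediam (Set.univ : Set S.LimitSpace) ≤ ENNReal.ofReal D := by
        refine Metric.ediam_le fun a _ b _ => ?_
        obtain ⟨a, rfl⟩ := Symbol.exists_point_eq a
        obtain ⟨b, rfl⟩ := Symbol.exists_point_eq b
        rw [edist_dist, hdist]
        exact ENNReal.ofReal_le_ofReal (hn.limitDist_le_weight_genEdges _ _)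
      exact (ENNReal.ofReal_le_ofReal_iff hD).1 (hrdiam.trans h1)
    have hLr : 1 ≤ L * r := by
      have h3 : S.ratio ^ 6 ≤ r := (pow_le_pow_of_le_one hpos.le hle1 (by omega)).trans hbig.le
      have := mul_le_mul_of_nonneg_left h3 (zero_lt_one.trans hL1).le
      linarith
    refine ⟨Metric.ball p r, Subtype.val, Metric.isOpen_ball, Subtype.range_coe, fun y z => ?_⟩
    have h0 : 0 ≤ dist y z := dist_nonneg
    refine hrescale _ _ ?_ ?_
    · exact le_mul_of_one_le_left h0 hLr
    · rw [mul_comm]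
      exact mul_le_mul_of_nonneg_right (by linarith) h0
  obtain ⟨n, hn1, hn2⟩ := exists_nat_pow_near_of_lt_one (div_pos hr (pow_pos hpos 3))
    ((div_le_one (pow_pos hpos 3)).2 hsmall) hpos (hn.ratio_le_half.trans_lt (by norm_num))
  rw [lt_div_iff₀ (by positivity), ← pow_add] at hn1
  rw [div_le_iff₀ (by positivity), ← pow_add] at hn2
  obtain ⟨x, rfl⟩ := Symbol.exists_point_eq p
  obtain ⟨v, hv⟩ := hn.exists_nearCentre x n
  obtain ⟨v', ⟨Θ⟩⟩ := exists_starIso hd hn n v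
  have hnear : ∀ y : S.Symbol,
      y.point ∈ Metric.ball x.point r → y.NearCentre n v := by
    intro y hy
    rw [Metric.mem_ball, hdist, hn.limitDist_comm] at hy
    exact hv y (hn.meetsAt_of_limitDist_lt (hy.trans_le hn2))
  let f : Metric.ball x.point r → S.LimitSpace := fun q => (Θ.map T (Quot.out q.1)).point
  have hf : ∀ (y : S.Symbol) (hy : y.point ∈ Metric.ball x.point r),
      f ⟨_, hy⟩ = (Θ.map T y).point := by
    intro y hy
    have hout : (Quot.out y.point).point = y.point := Quot.out_eq _
    have hy' : (Quot.out y.point).point ∈ Metric.ball x.point r := by rw [hout]; exact hy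
    refine hn.point_eq_iff.2 (StarIso.map_rel hn (hnear _ hy') (hnear y hy) ?_)
    exact (hn.point_eq_iff).1 hout
  refine ⟨Set.range f, f, Metric.isOpen_iff.2 ?_, rfl, ?_⟩
  · rintro _ ⟨⟨q, hq⟩, rfl⟩
    obtain ⟨y, rfl⟩ := Symbol.exists_point_eq q
    rw [hf]
    have hy := hnear y hq
    obtain ⟨k, hk⟩ := (((hn.tendsto_ratio_pow 2).eventually_lt_const
      (sub_pos.2 (Metric.mem_ball.1 hq)))).exists
    -- A point so close to the image of `y` comes from a point close to `y`.
    refine ⟨S.ratio ^ (k + 2 + 1), by positivity, fun q' hq' => ?_⟩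
    obtain ⟨z', rfl⟩ := Symbol.exists_point_eq q'
    rw [Metric.mem_ball, dist_comm, hdist] at hq'
    have hm := hn.meetsAt_of_limitDist_lt hq'
    obtain ⟨z, hz, rfl⟩ := StarIso.exists_map_eq (Θ := Θ) (T := T)
      ((StarIso.nearCentre_map hy).endpt_eq_of_meetsAt (hm.mono (by omega)))
    have hyz := hn.limitDist_le ((StarIso.meetsAt_map_iff hy hz k).1 hm)
    have hpow : S.ratio ^ (n + (k + 2) + 1) ≤ S.ratio ^ (k + 1) :=
      pow_le_pow_of_le_one hpos.le hle1 (by omega)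
    have hzball : z.point ∈
        Metric.ball x.point r := by
      have htri := dist_triangle z.point y.point
        x.point
      rw [hdist z y, hn.limitDist_comm] at htri
      rw [Metric.mem_ball]
      linarith
    exact ⟨⟨_, hzball⟩, hf z hzball⟩
  · rintro ⟨q, hq⟩ ⟨q', hq'⟩
    obtain ⟨y, rfl⟩ := Symbol.exists_point_eq q
    obtain ⟨z, rfl⟩ := Symbol.exists_point_eq q'
    rw [hf, hf, Subtype.dist_eq, hdist, hdist]
    have hup := StarIso.limitDist_map_le (Θ := Θ) (T := T) hn (hnear y hq) (hnear z hq')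
    have hlow := StarIso.le_limitDist_map (Θ := Θ) (T := T) hn (hnear y hq) (hnear z hq')
    have hA := hn.limitDist_nonneg y z
    have hB := hn.limitDist_nonneg (Θ.map T y) (Θ.map T z)
    generalize y.limitDist z = A at *
    generalize (Θ.map T y).limitDist (Θ.map T z) = B at *
    refine hrescale A B ?_ ?_
    · refine le_of_mul_le_mul_right ?_ (pow_pos hpos 2)
      calc A * S.ratio ^ 2 ≤ 2 * S.ratio ^ n * B := hlow
        _ ≤ (L * S.ratio ^ 6) * S.ratio ^ n * B := by gcongr
        _ = L * S.ratio ^ (n + 1 + 3) * B * S.ratio ^ 2 := by ring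
        _ ≤ L * r * B * S.ratio ^ 2 := by gcongr
    · have h2 : r ≤ S.ratio ^ (n + 2) :=
        hn2.trans (pow_le_pow_of_le_one hpos.le hle1 (by omega))
      calc B * r ≤ B * S.ratio ^ (n + 2) := by gcongr
        _ ≤ 2 * A := hup
        _ ≤ L * A := by
          gcongr
          linarith

end SimpleIGS

theorem mainTheorem8 (S : SimpleIGS.{u, w}) (hdoubling : S.IsDoubling)
    (hnondeg : S.IsNonDegenerate) (hsymm : S.IsSymmetric) :
    Equivalence S.SymbolRel ∧
      ∃ M : MetricSpace S.LimitSpace, S.IsIntrinsicMetric M ∧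
        @ApproximatelySelfSimilar S.LimitSpace M :=
  ⟨SimpleIGS.symbolRel_equivalence hnondeg, hnondeg.limitMetric, hnondeg.isIntrinsicMetric,
    hnondeg.approximatelySelfSimilar hdoubling hsymm⟩
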